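/- Throughout, graphs are finite and simple, $d(v)$ is the degree of $v$, $N(v)$ its set of neighbors, and $\Delta$ the maximum degree of $G$. A vertex $v$ is \emph{big} if $d(v)\ge 8680$, and \emph{very big} if $d(v)\ge \Delta-4\cdot 8680$. A $j$-vertex (respectively $j^-$-vertex, $j^+$-vertex) is a vertex of degree exactly (respectively at most, at least) $j$; $j^-$-neighbors and $j^+$-neighbors are defined in the same way. In a plane graph, a \emph{bunch} of length $t\ge 1$ with \emph{parents} $v\ne w$, both big, consists of vertices $x_1,\dots,x_t$ for which there are vertices $x_0$ and $x_{t+1}$ such that: $x_0,x_1,\dots,x_{t+1}$ are distinct and are successive neighbors of $v$ in the cyclic order around $v$, and also successive neighbors of $w$ in the cyclic order around $w$; $d(x_i)\le 4$ for $1\le i\le t$; and for each $1\le i\le t+1$ the 4-cycle $vx_iwx_{i-1}$ is not separating, that is, it bounds a 4-face or it bounds the two 3-faces $vx_ix_{i-1}$ and $wx_ix_{i-1}$. The vertices in the bunch are $x_1,\dots,x_t$ (not $x_0$ and $x_{t+1}$). For a vertex $v$, let $n_5(v)$ and $n_6(v)$ be the numbers of $5^-$-neighbors and of $6^+$-neighbors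 of $v$, respectively, that are in no bunch with $v$ as a parent. \textbf{Structural Lemma.} Let $G$ be a 2-connected plane graph (with at least three vertices), and let $k=\max\{\Delta,\,5\cdot 8680\}$. Then $G$ contains at least one of the following four configurations: (RC1) a vertex $v$ such that $\sum_{w\in N(v)}d(w)\le k$; (RC2) a big vertex $v$ such that, among those $5^-$-vertices that have $v$ as their unique big neighbor, there are either (i) at least $\max\{1,\,d(v)-\Delta+8889\}$ 2-vertices, or (ii) at least $\max\{1,\,d(v)-\Delta+17655\}$ $3^-$-vertices, or (iii) at least $\max\{1,\,d(v)-\Delta+26401\}$ $4^-$-vertices, or (iv) at least $\max\{1,\,d(v)-\Delta+35137\}$ $5^-$-vertices; (RC3) a big vertex $v$ such that $n_5(v)+2n_6(v)\le 35$; (RC4) a very big vertex $v$ such that $n_5(v)+2n_6(v)\le 141415$. -/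

import Mathlib

namespace PlaneGraph

/-- A graph is 2-connected if it has at least three vertices, is connected, and stays connected
after the deletion of any single vertex. -/
def IsTwoConnected {V : Type*} [Fintype V] (G : SimpleGraph V) : Prop :=
  3 ≤ Fintype.card V ∧ G.Connected ∧ ∀ v : V, (G.induce ({v}ᶜ : Set V)).Connected

/-- A rotation system on a graph: at every vertex `v`, the neighbors of `v` are arranged in one
cyclic order (the clockwise order around `v` in an embedding in an oriented surface);
`next v a` is the neighbor of `v` that comes right after the neighbor `a`. -/
structure RotationSystem {V : Type*} (G : SimpleGraph V) where
  next : ∀ v : V, Equiv.Perm (G.neighborSet v)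
  next_isCycleOn : ∀ v : V, (next v).IsCycleOn Set.univ

namespace RotationSystem

variable {V : Type*} {G : SimpleGraph V}

/-- Face tracing: the dart `a → v` is followed along its face by the dart `v → next v a`. -/
def facePerm (R : RotationSystem G) : Equiv.Perm G.Dart where
  toFun d := ⟨(d.snd, (R.next d.snd ⟨d.fst, d.adj.symm⟩ : V)),
    (R.next d.snd ⟨d.fst, d.adj.symm⟩).2⟩
  invFun d := ⟨(((R.next d.fst).symm ⟨d.snd, d.adj⟩ : V), d.fst),
    ((R.next d.fst).symm ⟨d.snd, d.adj⟩).2.symm⟩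
  left_inv d := by
    ext
    · exact congrArg Subtype.val
        ((R.next d.snd).symm_apply_apply ⟨d.fst, d.adj.symm⟩)
    · rfl
  right_inv d := by
    ext
    · rfl
    · exact congrArg Subtype.val ((R.next d.fst).apply_symm_apply ⟨d.snd, d.adj⟩)

/-- The faces: the orbits of the darts under face tracing. -/
def Face (R : RotationSystem G) : Type _ :=
  Quotient (Equiv.Perm.SameCycle.setoid R.facePerm)

/-- The face that has the dart `d` on its boundary walk.  The two sides of the edge of `d` are
`R.faceOf d` and `R.faceOf d.symm`. -/
def faceOf (R : RotationSystem G) (d : G.Dart) : R.Face :=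
  Quotient.mk (Equiv.Perm.SameCycle.setoid R.facePerm) d

/-- The surface obtained by gluing a disc to each facial walk is a sphere (for each component of
the graph): every cycle `c` of the graph separates it, that is, the faces split
into two classes (the two sides of `c`) so that exactly the edges of `c` lie between faces of
different classes, while every other edge has both of its sides in the same class. -/
def IsPlanar (R : RotationSystem G) : Prop :=
  ∀ (u : V) (c : G.Walk u u), c.IsCycle →
    ∃ S : Set R.Face, ∀ d : G.Dart,
      d.edge ∈ c.edges ↔ ¬ (R.faceOf d ∈ S ↔ R.faceOf d.symm ∈ S)

/-- `a` and `b` are neighbors of `u`, and `b` comes right after `a` in the cyclic order at `u`. -/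
def IsSucc (R : RotationSystem G) (u a b : V) : Prop :=
  ∃ h : G.Adj u a, (R.next u ⟨a, h⟩ : V) = b

/-- The closed walk `a b c` is the boundary walk of a face. -/
def IsFace3 (R : RotationSystem G) (a b c : V) : Prop :=
  R.IsSucc b a c ∧ R.IsSucc c b a ∧ R.IsSucc a c b

/-- The closed walk `a b c d` is the boundary walk of a face. -/
def IsFace4 (R : RotationSystem G) (a b c d : V) : Prop :=
  R.IsSucc b a c ∧ R.IsSucc c b d ∧ R.IsSucc d c a ∧ R.IsSucc a d b

end RotationSystem

/-- A plane graph structure on `G`: an embedding of `G` in the plane (or sphere), up to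
orientation-preserving homeomorphism, recorded by its rotation system. -/
structure PlaneEmbedding {V : Type*} (G : SimpleGraph V) extends RotationSystem G where
  isPlanar : toRotationSystem.IsPlanar

section Configurations

variable {V : Type*} [Fintype V] (G : SimpleGraph V) [DecidableRel G.Adj]

/-- A vertex is big if its degree is at least 8680. -/
def IsBig (v : V) : Prop := 8680 ≤ G.degree v

/-- A vertex is very big if its degree is at least `Δ - 4 · 8680`. -/
def IsVeryBig (v : V) : Prop := (G.maxDegree : ℤ) - 4 * 8680 ≤ (G.degree v : ℤ)

variable {G}

/-- `x 1, …, x t` are the vertices of a bunch of length `t ≥ 1` with parents `v` and `w`;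
`x 0` and `x (t + 1)` are the two flanking vertices, which are not in the bunch.  (The values
`x i` with `i > t + 1` play no role.)  The successive neighbors of `v` and of `w` run in
opposite rotational directions, as `v` and `w` lie on different sides of the `x i`. -/
structure IsBunch (R : RotationSystem G) (v w : V) (t : ℕ) (x : ℕ → V) : Prop where
  length_pos : 1 ≤ t
  parents_ne : v ≠ w
  big_left : IsBig G v
  big_right : IsBig G w
  injOn : Set.InjOn x (Set.Icc 0 (t + 1))
  succ_left : ∀ i ≤ t, R.IsSucc v (x i) (x (i + 1))
  succ_right : ∀ i ≤ t, R.IsSucc w (x (i + 1)) (x i)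
  degree_le : ∀ i, 1 ≤ i → i ≤ t → G.degree (x i) ≤ 4
  /-- The 4-cycle through `v, x i, w, x (i + 1)` is not separating: it bounds a 4-face, or it
  bounds the two 3-faces on either side of the edge joining `x i` and `x (i + 1)`. -/
  not_separating : ∀ i ≤ t,
    R.IsFace4 (x i) v (x (i + 1)) w ∨
      (R.IsFace3 (x i) v (x (i + 1)) ∧ R.IsFace3 (x (i + 1)) w (x i))

/-- The vertex `u` is in some bunch that has `v` as a parent. -/
def InBunchOf (R : RotationSystem G) (v u : V) : Prop :=
  ∃ (w : V) (t : ℕ) (x : ℕ → V), IsBunch R v w t x ∧ ∃ i, 1 ≤ i ∧ i ≤ t ∧ x i = u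

/-- `n₅(v)`: the number of neighbors of `v` of degree at most 5 that are in no bunch with `v` as
a parent. -/
noncomputable def nFive (R : RotationSystem G) (v : V) : ℕ :=
  {u : V | G.Adj v u ∧ G.degree u ≤ 5 ∧ ¬ InBunchOf R v u}.ncard

/-- `n₆(v)`: the number of neighbors of `v` of degree at least 6 that are in no bunch with `v` as
a parent. -/
noncomputable def nSix (R : RotationSystem G) (v : V) : ℕ :=
  {u : V | G.Adj v u ∧ 6 ≤ G.degree u ∧ ¬ InBunchOf R v u}.ncard

variable (G)

/-- The vertices of degree at most 5 that have `v` as their unique big neighbor. -/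
def soleBigNeighborSet (v : V) : Set V :=
  {w : V | G.degree w ≤ 5 ∧ G.Adj w v ∧ IsBig G v ∧ ∀ u : V, G.Adj w u → IsBig G u → u = v}

/-- (RC1) with bound `k`. -/
def HasRC1 (k : ℕ) : Prop :=
  ∃ v : V, ∑ w ∈ G.neighborFinset v, G.degree w ≤ k

/-- (RC2) -/
def HasRC2 : Prop :=
  ∃ v : V, IsBig G v ∧
    (max 1 ((G.degree v : ℤ) - G.maxDegree + 8889) ≤
        ({w ∈ soleBigNeighborSet G v | G.degree w = 2}.ncard : ℤ) ∨
      max 1 ((G.degree v : ℤ) - G.maxDegree + 17655) ≤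
        ({w ∈ soleBigNeighborSet G v | G.degree w ≤ 3}.ncard : ℤ) ∨
      max 1 ((G.degree v : ℤ) - G.maxDegree + 26401) ≤
        ({w ∈ soleBigNeighborSet G v | G.degree w ≤ 4}.ncard : ℤ) ∨
      max 1 ((G.degree v : ℤ) - G.maxDegree + 35137) ≤
        ({w ∈ soleBigNeighborSet G v | G.degree w ≤ 5}.ncard : ℤ))

variable {G}

/-- (RC3) -/
def HasRC3 (R : RotationSystem G) : Prop :=
  ∃ v : V, IsBig G v ∧ nFive R v + 2 * nSix R v ≤ 35

/-- (RC4) -/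
def HasRC4 (R : RotationSystem G) : Prop :=
  ∃ v : V, IsVeryBig G v ∧ nFive R v + 2 * nSix R v ≤ 141415

end Configurations

end PlaneGraph

/-! The proof is by discharging. Give each vertex the charge `2 d(v) - 12` and each face of length
`l` the charge `4 l - 12`; by Euler's inequality the total is at most `-24`. A big vertex sends
nothing to a neighbor of degree at least 6, sends 1 to a smaller neighbor outside its bunches and 2
to one inside, that is, `2 - weight`; it sends `soleDemand` on top to neighbors whose only big
neighbor it is. Faces of length at least 4 pay the corners that are not big and lie beside big
vertices along the face (`faceShare`). In a triangle with exactly two big vertices, the third corner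
gets 4, charged to the side joining the big ones (`triangleShare`).

If all four configurations are absent, every vertex that is not big ends with nonnegative charge
(`charge_nonneg`). The point is that a vertex of degree at most 4 with two big neighbors either is
in a bunch, and gets 2 from both parents, or has surrounding faces that pay enough
(`le_sum_share_of_not_inBunchOf`). A big vertex retains its total weight minus its sole demands,
which is at least 36 (`le_sum_weight_sub_soleDemand`), and so ends with at least `36 - 12 = 24`. The
triangles cost at most 4 per dart between big vertices, and planarity bounds the number of these
darts by `6 |B| + 4`, where `B` is the set of big vertices (`IsPlanar.card_edges_induce_le`). The
final total is then at least `24 |B| - 4 (6 |B| + 4) = -16`, contradicting `-24`. -/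

namespace PlaneGraph

/-! ### Euler's inequality from the separation property of cycles, by linear algebra over `ZMod 2`
-/

namespace RotationSystem

variable {V : Type*} {G : SimpleGraph V}

/-- **Euler's inequality**, relative form. Let `s` identify darts at least as coarsely as face
tracing together with crossing the edges outside `H` does not separate them, i.e. every function
invariant under these moves is constant on the classes of `s`. If `T ≤ H` connects the ends of
every edge of `H`, then the number of classes is at least `1 + |E(H)| - |E(T)|`. -/
theorem IsPlanar.card_edges_succ_le [Fintype V] {R : RotationSystem G} (hR : R.IsPlanar)
    {T H : SimpleGraph V} (hTH : T ≤ H) (hHG : H ≤ G)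
    (hT : ∀ a b, H.Adj a b → T.Reachable a b) (s : Setoid G.Dart) [Nonempty G.Dart]
    (hs : ∀ ψ : G.Dart → ZMod 2, (∀ d, ψ (R.facePerm d) = ψ d) →
      (∀ d : G.Dart, d.edge ∉ H.edgeSet → ψ d.symm = ψ d) → ∀ d d', s d d' → ψ d = ψ d') :
    H.edgeSet.ncard + 1 ≤ Nat.card (Quotient s) + T.edgeSet.ncard := by
  classical
  let N : Set (Sym2 V) := H.edgeSet \ T.edgeSet
  have hN : ∀ e : N, ∃ d : G.Dart, d.edge = e := by
    rintro ⟨e, he, -⟩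
    induction e with
    | h a b => exact ⟨⟨(a, b), hHG he⟩, rfl⟩
  choose δ hδ using hN
  -- `L` records the jump of a function on regions across each edge of `H` outside `T`. It is onto
  -- and kills the constants, so the number of regions exceeds the number of such edges.
  let L : (Quotient s → ZMod 2) →ₗ[ZMod 2] (N → ZMod 2) :=
    { toFun := fun φ e => φ (Quotient.mk s (δ e)) + φ (Quotient.mk s (δ e).symm)
      map_add' := fun φ φ' => by ext e; simp only [Pi.add_apply]; ring
      map_smul' := fun c φ => by ext e; simp [mul_add] }
  have key : ∀ e : N, ∃ φ, L φ = Pi.single e 1 := by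
    intro e
    have hadj : H.Adj (δ e).snd (δ e).fst := by
      have h1 : (δ e).edge ∈ H.edgeSet := by rw [hδ]; exact e.2.1
      have h2 : (δ e).edge = s((δ e).fst, (δ e).snd) := rfl
      rw [h2] at h1
      exact (H.mem_edgeSet.mp h1).symm
    obtain ⟨p, hp⟩ := (hT _ _ hadj).exists_isPath
    let q : G.Walk (δ e).snd (δ e).fst := p.mapLe (hTH.trans hHG)
    have hq : q.IsPath := (SimpleGraph.Walk.isPath_mapLe _).mpr hp
    have hqe : ∀ x ∈ q.edges, x ∈ T.edgeSet := by
      intro x hx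
      rw [SimpleGraph.Walk.edges_mapLe_eq_edges] at hx
      exact p.edges_subset_edgeSet hx
    have hnot : s((δ e).fst, (δ e).snd) ∉ q.edges := by
      intro h
      have h1 := hqe _ h
      have h2 : (e : Sym2 V) = s((δ e).fst, (δ e).snd) := (hδ e).symm
      exact e.2.2 (h2 ▸ h1)
    have hc : (SimpleGraph.Walk.cons (δ e).adj q).IsCycle :=
      (SimpleGraph.Walk.cons_isCycle_iff _ _).mpr ⟨hq, hnot⟩
    -- The indicator of one side of the fundamental cycle of `e` jumps exactly on that cycle, whose
    -- other edges lie in `T`. Hence it maps to the unit vector at `e`.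
    obtain ⟨S, hS⟩ := hR _ _ hc
    have hedges : ∀ d : G.Dart, d.edge ∈ (SimpleGraph.Walk.cons (δ e).adj q).edges ↔
        d.edge = e ∨ d.edge ∈ q.edges := by
      intro d
      rw [SimpleGraph.Walk.edges_cons, List.mem_cons]
      rw [← hδ e]; rfl
    let ψ : G.Dart → ZMod 2 := fun d => if R.faceOf d ∈ S then 1 else 0
    have hψ : ∀ d d', s d d' → ψ d = ψ d' := by
      apply hs
      · intro d
        have : R.faceOf (R.facePerm d) = R.faceOf d := by
          apply Quotient.sound
          exact (Equiv.Perm.sameCycle_apply_left).mpr (Equiv.Perm.SameCycle.refl _ _)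
        simp only [ψ, this]
      · intro d hd
        have h1 : d.edge ∉ (SimpleGraph.Walk.cons (δ e).adj q).edges := by
          rw [hedges]
          rintro (h | h)
          · exact hd (h ▸ e.2.1)
          · exact hd (SimpleGraph.edgeSet_mono hTH (hqe _ h))
        have h2 := (not_congr (hS d)).mp h1
        rw [not_not] at h2
        simp only [ψ, h2]
    refine ⟨Quotient.lift ψ hψ, ?_⟩
    ext e'
    change ψ (δ e') + ψ (δ e').symm = _
    have h1 : (δ e').edge ∈ (SimpleGraph.Walk.cons (δ e).adj q).edges ↔ e' = e := by
      rw [hedges, hδ]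
      constructor
      · rintro (h | h)
        · exact Subtype.ext h
        · exact absurd (hqe _ h) e'.2.2
      · rintro rfl; exact Or.inl rfl
    have h2 := hS (δ e')
    rw [h1] at h2
    by_cases he : e' = e
    · have h3 := h2.mp he
      subst he
      simp only [ψ, Pi.single_eq_same]
      by_cases h4 : R.faceOf (δ e') ∈ S <;> by_cases h5 : R.faceOf (δ e').symm ∈ S <;>
        simp_all
    · have h3 := (not_congr h2).mp he
      rw [not_not] at h3
      simp only [ψ, Pi.single_eq_of_ne he, h3]
      split_ifs
      · decide
      · decide
  have hsurj : LinearMap.range L = ⊤ := by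
    rw [eq_top_iff]
    intro g _
    rw [pi_eq_sum_univ g]
    refine Submodule.sum_mem _ fun e _ => Submodule.smul_mem _ _ ?_
    obtain ⟨φ, hφ⟩ := key e
    refine ⟨φ, ?_⟩
    rw [hφ]
    ext e'
    simp [Pi.single_apply, eq_comm]
  have hker : 1 ≤ Module.finrank (ZMod 2) (LinearMap.ker L) := by
    rw [Nat.one_le_iff_ne_zero]
    intro h0
    have hbot : LinearMap.ker L = ⊥ := Submodule.finrank_eq_zero.mp h0
    have hmem : (fun _ => 1 : Quotient s → ZMod 2) ∈ LinearMap.ker L := by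
      rw [LinearMap.mem_ker]
      ext e
      change (1 : ZMod 2) + 1 = 0
      decide
    rw [hbot, Submodule.mem_bot] at hmem
    have := congrFun hmem (Quotient.mk s (Classical.arbitrary _))
    exact one_ne_zero this
  have hrn := LinearMap.finrank_range_add_finrank_ker L
  rw [hsurj, finrank_top, Module.finrank_pi, Module.finrank_pi] at hrn
  have hNc : Fintype.card N = N.ncard := by
    rw [← Nat.card_eq_fintype_card, Nat.card_coe_set_eq]
  have hdiff : N.ncard + T.edgeSet.ncard = H.edgeSet.ncard :=
    Set.ncard_sdiff_add_ncard_of_subset (SimpleGraph.edgeSet_mono hTH)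
  have hQ : Nat.card (Quotient s) = Fintype.card (Quotient s) := Nat.card_eq_fintype_card
  omega

end RotationSystem
end PlaneGraph

/-! ### Euler's inequality for connected graphs, and the number of edges inside a vertex set -/

namespace PlaneGraph

namespace RotationSystem

variable {V : Type*} {G : SimpleGraph V}

/-- **Euler's inequality** for a connected plane graph. -/
theorem IsPlanar.euler [Fintype V] {R : RotationSystem G} (hR : R.IsPlanar)
    (hG : G.Connected) [Nonempty G.Dart] :
    G.edgeSet.ncard + 2 ≤ Nat.card R.Face + Fintype.card V := by
  classical
  obtain ⟨T, hT, htree⟩ := hG.exists_isTree_le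
  have h := hR.card_edges_succ_le hT le_rfl (fun a b _ => htree.connected a b)
    (Equiv.Perm.SameCycle.setoid R.facePerm) (by
      intro ψ hψ _ d d' hdd
      obtain ⟨n, hn⟩ := Equiv.Perm.SameCycle.exists_nat_pow_eq hdd
      rw [← hn]
      clear hn hdd
      induction n with
      | zero => rfl
      | succ n ih => rw [pow_succ', Equiv.Perm.mul_apply, hψ, ih])
  have h2 := htree.card_edgeFinset
  have h3 : T.edgeSet.ncard = T.edgeFinset.card := by
    rw [← SimpleGraph.coe_edgeFinset, Set.ncard_coe_finset]
  have h4 : Nat.card R.Face = Nat.card (Quotient (Equiv.Perm.SameCycle.setoid R.facePerm)) := rfl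
  omega

/-- The darts out of `a` form a copy of its neighbor set. -/
def dartOut (a : V) (x : G.neighborSet a) : G.Dart := ⟨(a, x), x.2⟩

theorem facePerm_symm_dartOut (R : RotationSystem G) (a : V) (x : G.neighborSet a) :
    R.facePerm (dartOut a x).symm = dartOut a (R.next a x) := rfl

/-- The edges at `a` that lie between darts with different values of a function that is constant
on faces come in an even number; in particular, there is no single one. -/
theorem exists_ne_of_symm_ne [Finite V] (R : RotationSystem G) {ψ : G.Dart → ZMod 2}
    (hψ : ∀ d, ψ (R.facePerm d) = ψ d) {a : V} (x : G.neighborSet a)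
    (hx : ψ (dartOut a x).symm ≠ ψ (dartOut a x)) :
    ∃ y : G.neighborSet a, y ≠ x ∧ ψ (dartOut a y).symm ≠ ψ (dartOut a y) := by
  classical
  have := Fintype.ofFinite V
  by_contra! hcon
  have h1 : ∑ y : G.neighborSet a, ψ (dartOut a y).symm = ∑ y : G.neighborSet a, ψ (dartOut a y) := by
    rw [← Equiv.sum_comp (R.next a) (fun y => ψ (dartOut a y))]
    refine Finset.sum_congr rfl fun y _ => ?_
    rw [← facePerm_symm_dartOut, hψ]
  rw [← Finset.add_sum_erase _ _ (Finset.mem_univ x),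
    ← Finset.add_sum_erase _ (fun y => ψ (dartOut a y)) (Finset.mem_univ x)] at h1
  rw [Finset.sum_congr rfl (g := fun y => ψ (dartOut a y))
    (fun y hy => hcon y (Finset.ne_of_mem_erase hy))] at h1
  exact hx (add_right_cancel h1)

/-- A set of darts that is closed under face tracing and under reversal is everything. -/
theorem eq_of_facePerm_of_symm (R : RotationSystem G) [Finite V] (hG : G.Connected)
    {α : Type*} {ψ : G.Dart → α} (hψ : ∀ d, ψ (R.facePerm d) = ψ d)
    (hsymm : ∀ d : G.Dart, ψ d.symm = ψ d) (d d' : G.Dart) : ψ d = ψ d' := by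
  classical
  have := Fintype.ofFinite V
  have hrot : ∀ (a : V) (x y : G.neighborSet a), ψ (dartOut a x) = ψ (dartOut a y) := by
    intro a x y
    obtain ⟨n, hn⟩ := ((R.next_isCycleOn a).2 (Set.mem_univ x) (Set.mem_univ y)).exists_nat_pow_eq
    rw [← hn]
    clear hn
    induction n with
    | zero => rfl
    | succ n ih =>
      rw [pow_succ', Equiv.Perm.mul_apply, ← facePerm_symm_dartOut, hψ, hsymm, ih]
  have hwalk : ∀ (a b : V) (_ : G.Walk a b) (x : G.neighborSet a) (y : G.neighborSet b),
      ψ (dartOut a x) = ψ (dartOut b y) := by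
    intro a b w
    induction w with
    | nil => intro x y; exact hrot _ x y
    | @cons a c b h p ih =>
      intro x y
      rw [hrot a x ⟨c, h⟩, ← hsymm, ← ih ⟨a, h.symm⟩ y]
      rfl
  obtain ⟨w⟩ := hG d.fst d'.fst
  exact hwalk _ _ w ⟨d.snd, d.adj⟩ ⟨d'.snd, d'.adj⟩

/-- The number of edges of a plane graph inside a set of vertices. -/
theorem IsPlanar.card_edges_induce_le [Fintype V] {R : RotationSystem G} (hR : R.IsPlanar)
    (hG : G.Connected) (B : Set V) :
    {d : G.Dart | d.fst ∈ B ∧ d.snd ∈ B}.ncard ≤ 6 * B.ncard + 4 := by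
  classical
  let DB : Set G.Dart := {d : G.Dart | d.fst ∈ B ∧ d.snd ∈ B}
  let H : SimpleGraph V := (G.induce B).map (Function.Embedding.subtype _)
  have hHadj : ∀ a b, H.Adj a b ↔ G.Adj a b ∧ a ∈ B ∧ b ∈ B := by
    intro a b
    simp only [H, SimpleGraph.map_adj, SimpleGraph.comap_adj, Function.Embedding.subtype_apply]
    constructor
    · rintro ⟨u, v, h, rfl, rfl⟩; exact ⟨h, u.2, v.2⟩
    · rintro ⟨h, ha, hb⟩; exact ⟨⟨a, ha⟩, ⟨b, hb⟩, h, rfl, rfl⟩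
  have hHG : H ≤ G := fun a b h => ((hHadj a b).mp h).1
  have hHd : ∀ d : G.Dart, d.edge ∈ H.edgeSet ↔ d ∈ DB := by
    intro d
    change H.Adj d.fst d.snd ↔ _
    rw [hHadj]
    exact ⟨fun h => h.2, fun h => ⟨d.adj, h⟩⟩
  have hDB : DB.ncard = 2 * H.edgeSet.ncard := by
    let F : H.Dart → G.Dart := fun d => ⟨d.toProd, hHG d.adj⟩
    have hF : Function.Injective F := by
      intro d d' h
      have h2 : (F d).toProd = (F d').toProd := congrArg SimpleGraph.Dart.toProd h
      exact SimpleGraph.Dart.ext _ _ h2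
    have himg : DB = F '' Set.univ := by
      ext d
      constructor
      · intro hd
        exact ⟨⟨d.toProd, (hHadj _ _).mpr ⟨d.adj, hd⟩⟩, trivial, rfl⟩
      · rintro ⟨d, -, rfl⟩
        exact ((hHadj _ _).mp d.adj).2
    rw [himg, Set.ncard_image_of_injective _ hF, Set.ncard_univ, Nat.card_eq_fintype_card,
      H.dart_card_eq_twice_card_edges, ← SimpleGraph.coe_edgeFinset, Set.ncard_coe_finset]
  change DB.ncard ≤ _
  -- With the additive constant 4, a counterexample has at least five darts inside `B`; thus a lone
  -- region also meets three of them, and small `B` need no separate treatment.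
  by_contra! hlt
  have hDBne : DB.Nonempty := by
    rw [← Set.ncard_pos]; omega
  obtain ⟨d₀, hd₀⟩ := hDBne
  have : Nonempty G.Dart := ⟨d₀⟩
  have : Nonempty B := ⟨⟨d₀.fst, hd₀.1⟩⟩
  obtain ⟨T₀, hT₀, hac, hreach⟩ := (G.induce B).exists_isAcyclic_reachable_eq_le
  let T : SimpleGraph V := T₀.map (Function.Embedding.subtype _)
  have hTcard : T.edgeSet.ncard + 1 ≤ B.ncard := by
    -- Extending the forest to a spanning tree of the complete graph on `B` bounds its edges by `|B|
    -- - 1`.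
    obtain ⟨T', hT', hle, htree⟩ :=
      (SimpleGraph.connected_top (V := B)).exists_isTree_le_of_le_of_isAcyclic
        (H := T₀) le_top hac
    have h1 := htree.card_edgeFinset
    have h2 : T.edgeSet.ncard ≤ T₀.edgeSet.ncard := by
      rw [SimpleGraph.edgeSet_map]
      exact Set.ncard_image_le (Set.toFinite _)
    have h3 : T₀.edgeSet.ncard ≤ T'.edgeSet.ncard :=
      Set.ncard_le_ncard (SimpleGraph.edgeSet_mono (by assumption)) (Set.toFinite _)
    have h4 : T'.edgeSet.ncard = T'.edgeFinset.card := by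
      rw [← SimpleGraph.coe_edgeFinset, Set.ncard_coe_finset]
    have h5 : Fintype.card B = B.ncard := by
      rw [← Nat.card_eq_fintype_card, Nat.card_coe_set_eq]
    omega
  have hTH : T ≤ H := SimpleGraph.map_monotone _ hT₀
  have hT : ∀ a b, H.Adj a b → T.Reachable a b := by
    intro a b h
    obtain ⟨h, ha, hb⟩ := (hHadj a b).mp h
    have h1 : (G.induce B).Reachable ⟨a, ha⟩ ⟨b, hb⟩ := SimpleGraph.Adj.reachable h
    rw [← hreach] at h1
    exact h1.map (SimpleGraph.Embedding.map (Function.Embedding.subtype _) T₀).toHom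
  -- The classes are the regions left when only the edges of `H` are kept: faces of `G` are merged
  -- across all other edges.
  let r : G.Dart → G.Dart → Prop := fun d d' =>
    d' = R.facePerm d ∨ (d.edge ∉ H.edgeSet ∧ d' = d.symm)
  let s : Setoid G.Dart := Relation.EqvGen.setoid r
  have hcount := hR.card_edges_succ_le hTH hHG hT s (by
    intro ψ h1 h2 d d' h
    induction h with
    | rel x y h =>
      rcases h with rfl | ⟨h, rfl⟩
      · exact (h1 _).symm
      · exact (h2 _ h).symm
    | refl x => rfl
    | symm x y _ ih => exact ih.symm
    | trans x y z _ _ ih1 ih2 => exact ih1.trans ih2)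
  have hsf : ∀ d, Quotient.mk s (R.facePerm d) = Quotient.mk s d := fun d =>
    (Quotient.sound (Relation.EqvGen.rel (r := r) _ _ (Or.inl rfl))).symm
  have hss : ∀ d : G.Dart, d ∉ DB → Quotient.mk s d.symm = Quotient.mk s d := fun d hd =>
    (Quotient.sound (Relation.EqvGen.rel (r := r) _ _ (Or.inr ⟨fun h => hd ((hHd d).mp h), rfl⟩))).symm
  have hthree : ∀ q : Quotient s,
      3 ≤ ((DB.toFinset).filter (fun d => Quotient.mk s d = q)).card := by
    intro q
    let ψ : G.Dart → ZMod 2 := fun d => if Quotient.mk s d = q then 1 else 0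
    have hψ : ∀ d, ψ (R.facePerm d) = ψ d := fun d => by simp only [ψ, hsf]
    have hψs : ∀ d : G.Dart, ψ d.symm ≠ ψ d → d ∈ DB := by
      intro d h
      by_contra hd
      exact h (by simp only [ψ, hss d hd])
    -- Either the region is everything, or some edge bounds it. By parity the boundary has no vertex
    -- of degree one, so it continues at both ends of that edge; as the graph is simple, this gives
    -- three distinct edges.
    by_cases hall : ∀ d : G.Dart, ψ d.symm = ψ d
    · obtain ⟨d₁, rfl⟩ := Quotient.exists_rep q
      have h1 : (DB.toFinset).filter (fun d => Quotient.mk s d = Quotient.mk s d₁) = DB.toFinset := by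
        refine Finset.filter_true_of_mem fun d _ => ?_
        have := R.eq_of_facePerm_of_symm hG hψ hall d d₁
        by_contra hne
        simp only [ψ, if_neg hne] at this
        exact zero_ne_one this
      rw [h1, ← Set.ncard_eq_toFinset_card']
      omega
    · push Not at hall
      obtain ⟨d, hd⟩ := hall
      have hpick : ∀ d : G.Dart, ψ d.symm ≠ ψ d →
          ∃ d' ∈ (DB.toFinset).filter (fun d => Quotient.mk s d = q), d'.edge = d.edge := by
        intro d h
        have hd := hψs d h
        by_cases hq : Quotient.mk s d = q
        · exact ⟨d, by simp [hd, hq], rfl⟩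
        · refine ⟨d.symm, ?_, SimpleGraph.Dart.edge_symm d⟩
          have : Quotient.mk s d.symm = q := by
            by_contra hq'
            exact h (by simp only [ψ, if_neg hq, if_neg hq'])
          simp only [Finset.mem_filter, Set.mem_toFinset]
          exact ⟨⟨hd.2, hd.1⟩, this⟩
      obtain ⟨y, hy, hy'⟩ := R.exists_ne_of_symm_ne hψ (a := d.fst) ⟨d.snd, d.adj⟩ hd
      obtain ⟨z, hz, hz'⟩ := R.exists_ne_of_symm_ne hψ (a := d.snd) ⟨d.fst, d.adj.symm⟩
        (by exact hd.symm)
      obtain ⟨e₁, he₁, he₁'⟩ := hpick d hd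
      obtain ⟨e₂, he₂, he₂'⟩ := hpick _ hy'
      obtain ⟨e₃, he₃, he₃'⟩ := hpick _ hz'
      have hy2 : (y : V) ≠ d.snd := fun h => hy (Subtype.ext h)
      have hz2 : (z : V) ≠ d.fst := fun h => hz (Subtype.ext h)
      have hne := d.adj.ne
      have hE1 : d.edge = s(d.fst, d.snd) := rfl
      have hE2 : (dartOut d.fst y).edge = s(d.fst, (y : V)) := rfl
      have hE3 : (dartOut d.snd z).edge = s(d.snd, (z : V)) := rfl
      have hcard : ({e₁, e₂, e₃} : Finset G.Dart).card = 3 := by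
        refine Finset.card_eq_three.mpr ⟨e₁, e₂, e₃, ?_, ?_, ?_, rfl⟩
        · rintro rfl
          rw [he₁', hE1, hE2, Sym2.eq_iff] at he₂'
          grind
        · rintro rfl
          rw [he₁', hE1, hE3, Sym2.eq_iff] at he₃'
          grind
        · rintro rfl
          rw [he₂', hE2, hE3, Sym2.eq_iff] at he₃'
          grind
      rw [← hcard]
      apply Finset.card_le_card
      intro e he
      simp only [Finset.mem_insert, Finset.mem_singleton] at he
      rcases he with rfl | rfl | rfl <;> assumption
  have hsum : 3 * Nat.card (Quotient s) ≤ DB.ncard := by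
    rw [Set.ncard_eq_toFinset_card' DB,
      Finset.card_eq_sum_card_fiberwise (t := Finset.univ) (f := fun d => Quotient.mk s d)
        (fun _ _ => Finset.mem_coe.mpr (Finset.mem_univ _)),
      Nat.card_eq_fintype_card, mul_comm, ← Finset.card_univ, ← smul_eq_mul]
    exact Finset.card_nsmul_le_sum _ _ _ fun q _ => hthree q
  omega

end RotationSystem
end PlaneGraph

/-! ### Charge given by faces to their corners -/

namespace PlaneGraph

theorem mem_periodicPts_perm {α : Type*} [Finite α] (f : Equiv.Perm α) (x : α) :
    x ∈ Function.periodicPts f :=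
  ⟨orderOf f, orderOf_pos f, by
    change f^[orderOf f] x = x
    rw [Equiv.Perm.iterate_eq_pow, pow_orderOf_eq_one, Equiv.Perm.one_apply]⟩

theorem sum_sameCycle {α M : Type*} [Fintype α] [AddCommMonoid M] (f : Equiv.Perm α)
    (x : α) [DecidablePred (f.SameCycle x)] (g : α → M) :
    ∑ y with f.SameCycle x y, g y =
      ∑ i ∈ Finset.range (Function.minimalPeriod f x), g (f^[i] x) := by
  have hx := mem_periodicPts_perm f x
  symm
  refine Finset.sum_bij (fun i _ => f^[i] x) ?_ ?_ ?_ (fun _ _ => rfl)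
  · intro i _
    simp only [Finset.mem_filter, Finset.mem_univ, true_and]
    exact ⟨i, by rw [zpow_natCast, Equiv.Perm.iterate_eq_pow]⟩
  · intro i hi j hj h
    exact Function.iterate_injOn_Iio_minimalPeriod
      (Set.mem_Iio.mpr (Finset.mem_range.mp hi)) (Set.mem_Iio.mpr (Finset.mem_range.mp hj)) h
  · intro y hy
    obtain ⟨n, hn⟩ := (Finset.mem_filter.mp hy).2.exists_nat_pow_eq
    refine ⟨n % Function.minimalPeriod f x, Finset.mem_range.mpr
      (Nat.mod_lt _ (Function.minimalPeriod_pos_of_mem_periodicPts hx)), ?_⟩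
    rw [Function.iterate_mod_minimalPeriod_eq, Equiv.Perm.iterate_eq_pow, hn]

/-- Turns a bound per face into a global one: applied to face tracing, orbits are faces and periods
are face lengths. -/
theorem sum_le_of_sum_orbit_le {α : Type*} [Fintype α] (f : Equiv.Perm α) (g : α → ℤ)
    (a b : ℤ) (h : ∀ x, ∑ i ∈ Finset.range (Function.minimalPeriod f x), g (f^[i] x) ≤
      a * Function.minimalPeriod f x - b) :
    ∑ x, g x ≤ a * Fintype.card α -
      b * Nat.card (Quotient (Equiv.Perm.SameCycle.setoid f)) := by
  classical
  let s := Equiv.Perm.SameCycle.setoid f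
  have hfib : ∀ (x : α) (φ : α → ℤ), ∑ y with Quotient.mk s y = Quotient.mk s x, φ y =
      ∑ i ∈ Finset.range (Function.minimalPeriod f x), φ (f^[i] x) := by
    intro x φ
    rw [← sum_sameCycle]
    refine Finset.sum_congr (Finset.filter_congr fun y _ => ?_) fun _ _ => rfl
    rw [Quotient.eq]
    exact Equiv.Perm.sameCycle_comm
  have key : ∀ q : Quotient s, ∑ y with Quotient.mk s y = q, g y ≤
      a * (∑ y with Quotient.mk s y = q, 1) - b := by
    intro q
    obtain ⟨x, rfl⟩ := Quotient.exists_rep q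
    rw [hfib, hfib]
    simpa using h x
  have hsum := Finset.sum_le_sum fun q (_ : q ∈ Finset.univ) => key q
  rw [Finset.sum_fiberwise, Finset.sum_sub_distrib, ← Finset.mul_sum, Finset.sum_fiberwise] at hsum
  simp only [Finset.sum_const, Finset.card_univ, nsmul_eq_mul, mul_one] at hsum
  rw [Nat.card_eq_fintype_card]
  linarith

/-- The charge that a corner of a face of length `l` receives from the face, when `q` says whether
the vertex of the corner is big and `p`, `r` whether its two neighbors along the face are. -/
def faceShare (l : ℕ) (p q r : Bool) : ℤ :=
  if q = true ∨ l ≤ 3 then 0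
  else if l = 4 then (if p = true ∨ r = true then 2 else 0)
  else (if p = true then 2 else 0) + (if r = true then 2 else 0)

theorem faceShare_nonneg (l : ℕ) (p q r : Bool) : 0 ≤ faceShare l p q r := by
  unfold faceShare; split_ifs <;> simp

/-- From length 6 on, each side with exactly one big end transfers 2, and `2 l ≤ 4 l - 12`. Lengths
4 and 5 are tight and are checked over all patterns of big vertices. -/
theorem sum_faceShare_le {l : ℕ} (hl : 3 ≤ l) (b : ℕ → Bool) (h0 : b l = b 0)
    (h1 : b (l + 1) = b 1) :
    ∑ i ∈ Finset.range l, faceShare l (b i) (b (i + 1)) (b (i + 2)) ≤ 4 * l - 12 := by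
  rcases Nat.lt_or_ge l 6 with h6 | h6
  · interval_cases l
    · simp [faceShare]
    · simp only [Finset.sum_range_succ, Finset.sum_range_zero] at *
      norm_num at *
      rw [h0, h1]
      generalize b 0 = x0; generalize b 1 = x1; generalize b 2 = x2; generalize b 3 = x3
      revert x0 x1 x2 x3
      decide
    · simp only [Finset.sum_range_succ, Finset.sum_range_zero] at *
      norm_num at *
      rw [h0, h1]
      generalize b 0 = x0; generalize b 1 = x1; generalize b 2 = x2; generalize b 3 = x3
      generalize b 4 = x4
      revert x0 x1 x2 x3 x4
      decide
  -- `u` and `w` are the transfers along a side in the forward and in the backward direction.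
  · let u : ℕ → ℤ := fun i => if b i = true ∧ b (i + 1) = false then 2 else 0
    let w : ℕ → ℤ := fun i => if b i = false ∧ b (i + 1) = true then 2 else 0
    have hsplit : ∀ i, faceShare l (b i) (b (i + 1)) (b (i + 2)) = u i + w (i + 1) := by
      intro i
      have h2 : ¬ l ≤ 3 := by omega
      have h3 : l ≠ 4 := by omega
      simp only [faceShare, u, w, h2, h3, or_false, if_false]
      cases b i <;> cases b (i + 1) <;> cases b (i + 2) <;> simp
    have hshift : ∑ i ∈ Finset.range l, w (i + 1) = ∑ i ∈ Finset.range l, w i := by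
      have e1 := Finset.sum_range_succ w l
      have e2 := Finset.sum_range_succ' w l
      have e3 : w l = w 0 := by simp only [w, h0, h1, zero_add]
      linarith
    have hle : ∀ i, u i + w i ≤ 2 := by
      intro i
      simp only [u, w]
      cases b i <;> cases b (i + 1) <;> simp
    calc ∑ i ∈ Finset.range l, faceShare l (b i) (b (i + 1)) (b (i + 2))
        = ∑ i ∈ Finset.range l, (u i + w i) := by
          rw [Finset.sum_congr rfl fun i _ => hsplit i, Finset.sum_add_distrib, hshift,
            Finset.sum_add_distrib]
      _ ≤ ∑ i ∈ Finset.range l, 2 := Finset.sum_le_sum fun i _ => hle i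
      _ ≤ 4 * l - 12 := by
          rw [Finset.sum_const, Finset.card_range, nsmul_eq_mul]
          have : (6 : ℤ) ≤ l := by exact_mod_cast h6
          linarith

namespace RotationSystem

variable {V : Type*} {G : SimpleGraph V}

/-- The length of the face along the dart `d`. -/
noncomputable def faceLen (R : RotationSystem G) (d : G.Dart) : ℕ :=
  Function.minimalPeriod R.facePerm d

theorem faceLen_facePerm [Finite V] (R : RotationSystem G) (d : G.Dart) :
    R.faceLen (R.facePerm d) = R.faceLen d := by
  classical
  have := Fintype.ofFinite V
  exact Function.minimalPeriod_apply (mem_periodicPts_perm _ _)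

@[simp] theorem facePerm_fst (R : RotationSystem G) (d : G.Dart) :
    (R.facePerm d).fst = d.snd := rfl

theorem facePerm_iterate_faceLen (R : RotationSystem G) (d : G.Dart) :
    R.facePerm^[R.faceLen d] d = d := Function.iterate_minimalPeriod

/-- The total charge received by the corners from their faces. -/
theorem sum_faceShare_le [Fintype V] [DecidableRel G.Adj] (R : RotationSystem G)
    (hlen : ∀ d, 3 ≤ R.faceLen d) (β : V → Bool) :
    ∑ d : G.Dart, faceShare (R.faceLen d) (β d.fst) (β d.snd) (β (R.facePerm d).snd) ≤
      4 * Fintype.card G.Dart - 12 * Nat.card R.Face := by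
  classical
  refine sum_le_of_sum_orbit_le R.facePerm _ 4 12 fun d => ?_
  have hl : ∀ i, R.faceLen (R.facePerm^[i] d) = R.faceLen d := by
    intro i
    induction i with
    | zero => rfl
    | succ i ih => rw [Function.iterate_succ_apply', faceLen_facePerm, ih]
  have hper := R.facePerm_iterate_faceLen d
  have h := PlaneGraph.sum_faceShare_le (hlen d) (fun i => β (R.facePerm^[i] d).fst)
    (by simp only [hper, Function.iterate_zero, id])
    (by simp only [Function.iterate_succ_apply', hper, Function.iterate_zero, id])
  refine le_trans (le_of_eq (Finset.sum_congr rfl fun i _ => ?_)) h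
  rw [hl]
  simp only [Function.iterate_succ_apply', facePerm_fst]

/-- The charge that a corner receives from a triangle with two big vertices at its far side. -/
noncomputable def triangleShare (R : RotationSystem G) (β : V → Bool) (d : G.Dart) : ℤ :=
  if R.faceLen d = 3 ∧ β d.fst = true ∧ β d.snd = false ∧ β (R.facePerm d).snd = true then 4 else 0

theorem triangleShare_nonneg (R : RotationSystem G) (β : V → Bool) (d : G.Dart) :
    0 ≤ R.triangleShare β d := by
  unfold triangleShare; split_ifs <;> simp

theorem sum_triangleShare_le [Fintype V] [DecidableRel G.Adj] (R : RotationSystem G)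
    (β : V → Bool) :
    ∑ d : G.Dart, R.triangleShare β d ≤
      4 * ({d : G.Dart | β d.fst = true ∧ β d.snd = true}.ncard : ℤ) := by
  classical
  have h : ∑ d : G.Dart, R.triangleShare β d ≤
      ∑ d : G.Dart, if β d.fst = true ∧ β d.snd = true then (4 : ℤ) else 0 := by
    -- In a triangle, two face-tracing steps lead from the dart entering the corner to the opposite
    -- side, which pays.
    rw [← Equiv.sum_comp (R.facePerm * R.facePerm)
      (fun d => if β d.fst = true ∧ β d.snd = true then (4 : ℤ) else 0)]
    refine Finset.sum_le_sum fun d _ => ?_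
    unfold triangleShare
    split_ifs with h1 h2
    · exact le_rfl
    · exfalso
      apply h2
      obtain ⟨hl, ha, -, hc⟩ := h1
      have hper := R.facePerm_iterate_faceLen d
      rw [hl] at hper
      have h3 : (R.facePerm (R.facePerm d)).snd = d.fst := by
        rw [← facePerm_fst]
        exact congrArg (fun e : G.Dart => e.fst) hper
      simp only [Equiv.Perm.mul_apply]
      rw [facePerm_fst, h3]
      exact ⟨hc, ha⟩
    · norm_num
    · exact le_rfl
  refine h.trans (le_of_eq ?_)
  rw [← Finset.sum_filter, Finset.sum_const, nsmul_eq_mul, mul_comm, Set.ncard_eq_toFinset_card']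
  congr 3
  ext d; simp

/-- Every face has at least three sides. -/
theorem three_le_faceLen [Fintype V] [DecidableRel G.Adj] (R : RotationSystem G)
    (hdeg : ∀ v, 2 ≤ G.degree v) (d : G.Dart) : 3 ≤ R.faceLen d := by
  classical
  have hpos : 0 < R.faceLen d :=
    Function.minimalPeriod_pos_of_mem_periodicPts (mem_periodicPts_perm _ _)
  have hper := R.facePerm_iterate_faceLen d
  by_contra! hlt
  interval_cases hl : R.faceLen d
  · have h1 : (R.facePerm d).fst = d.fst := congrArg (fun e : G.Dart => e.fst) hper
    exact d.adj.ne h1.symm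
  -- A face of length two would give the rotation at `d.snd` a fixed point, but it is a single cycle
  -- on at least two neighbors.
  · have h1 : (R.facePerm d).snd = d.fst := congrArg (fun e : G.Dart => e.fst) hper
    have hnt : (Set.univ : Set (G.neighborSet d.snd)).Nontrivial := by
      rw [Set.nontrivial_univ_iff, ← Fintype.one_lt_card_iff_nontrivial,
        SimpleGraph.card_neighborSet_eq_degree]
      exact hdeg _
    have hfix : R.next d.snd ⟨d.fst, d.adj.symm⟩ = ⟨d.fst, d.adj.symm⟩ := Subtype.ext h1
    exact (R.next_isCycleOn d.snd).apply_ne hnt (Set.mem_univ _) hfix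

end RotationSystem
end PlaneGraph

/-! ### Short faces around a vertex, and bunch membership as a local condition -/

namespace PlaneGraph

namespace RotationSystem

variable {V : Type*} {G : SimpleGraph V}

theorem isSucc_dart (R : RotationSystem G) (d : G.Dart) :
    R.IsSucc d.snd d.fst (R.facePerm d).snd := ⟨d.adj.symm, rfl⟩

theorem IsSucc.facePerm_eq {R : RotationSystem G} {a b c : V} (h : R.IsSucc b a c)
    (hab : G.Adj a b) : ∃ hbc : G.Adj b c, R.facePerm ⟨(a, b), hab⟩ = ⟨(b, c), hbc⟩ := by
  obtain ⟨h1, rfl⟩ := h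
  exact ⟨(R.next b ⟨a, h1⟩).2, rfl⟩

theorem isFace3_of_faceLen {R : RotationSystem G} {d : G.Dart} (h : R.faceLen d = 3) :
    R.IsFace3 (R.facePerm d).snd d.fst d.snd := by
  have hper := R.facePerm_iterate_faceLen d
  rw [h] at hper
  have h1 : R.facePerm (R.facePerm (R.facePerm d)) = d := hper
  have h2 : (R.facePerm (R.facePerm d)).snd = d.fst :=
    congrArg (fun e : G.Dart => e.fst) h1
  refine ⟨?_, R.isSucc_dart d, ?_⟩
  · have := R.isSucc_dart (R.facePerm (R.facePerm d))
    rwa [h1, h2] at this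
  · have := R.isSucc_dart (R.facePerm d)
    rwa [h2] at this

theorem isFace4_of_faceLen {R : RotationSystem G} {d : G.Dart} (h : R.faceLen d = 4) :
    R.IsFace4 (R.facePerm (R.facePerm d)).snd d.fst d.snd (R.facePerm d).snd := by
  have hper := R.facePerm_iterate_faceLen d
  rw [h] at hper
  have h1 : R.facePerm (R.facePerm (R.facePerm (R.facePerm d))) = d := hper
  have h2 : (R.facePerm (R.facePerm (R.facePerm d))).snd = d.fst :=
    congrArg (fun e : G.Dart => e.fst) h1
  refine ⟨?_, R.isSucc_dart d, R.isSucc_dart (R.facePerm d), ?_⟩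
  · have := R.isSucc_dart (R.facePerm (R.facePerm (R.facePerm d)))
    rwa [h1, h2] at this
  · have := R.isSucc_dart (R.facePerm (R.facePerm d))
    rwa [h2] at this

theorem IsFace4.faceLen_eq {R : RotationSystem G} {a b c d : V} (h : R.IsFace4 a b c d)
    (hbc : G.Adj b c) (hlen : 3 ≤ R.faceLen ⟨(b, c), hbc⟩) : R.faceLen ⟨(b, c), hbc⟩ = 4 := by
  obtain ⟨hb, hc, hd, ha⟩ := h
  obtain ⟨h1, e1⟩ := hc.facePerm_eq hbc
  obtain ⟨h2, e2⟩ := hd.facePerm_eq h1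
  obtain ⟨h3, e3⟩ := ha.facePerm_eq h2
  obtain ⟨h4, e4⟩ := hb.facePerm_eq h3
  have hp : Function.IsPeriodicPt R.facePerm 4 ⟨(b, c), hbc⟩ := by
    change R.facePerm (R.facePerm (R.facePerm (R.facePerm _))) = _
    rw [e1, e2, e3, e4]
  have hdvd : R.faceLen ⟨(b, c), hbc⟩ ∣ 4 := hp.minimalPeriod_dvd
  have hle := Nat.le_of_dvd (by norm_num) hdvd
  interval_cases hl : R.faceLen ⟨(b, c), hbc⟩
  · omega
  · rfl

theorem minimalPeriod_next [Fintype V] [DecidableRel G.Adj] (R : RotationSystem G) (x : V)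
    (a : G.neighborSet x) : Function.minimalPeriod (R.next x) a = G.degree x := by
  classical
  have h := sum_sameCycle (R.next x) a (fun _ => 1)
  rw [Finset.filter_true_of_mem fun y _ =>
    (R.next_isCycleOn x).2 (Set.mem_univ a) (Set.mem_univ y)] at h
  rw [Finset.sum_const, Finset.sum_const, Finset.card_univ, Finset.card_range,
    SimpleGraph.card_neighborSet_eq_degree, smul_eq_mul, smul_eq_mul, mul_one, mul_one] at h
  exact h.symm

theorem sum_neighborSet [Fintype V] [DecidableRel G.Adj] (R : RotationSystem G) (x : V)
    (a : G.neighborSet x) (φ : G.neighborSet x → ℤ) :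
    ∑ y, φ y = ∑ i ∈ Finset.range (G.degree x), φ ((R.next x)^[i] a) := by
  classical
  rw [← R.minimalPeriod_next x a, ← sum_sameCycle]
  rw [Finset.filter_true_of_mem fun y _ =>
    (R.next_isCycleOn x).2 (Set.mem_univ a) (Set.mem_univ y)]

theorem iterate_next_degree [Fintype V] [DecidableRel G.Adj] (R : RotationSystem G) (x : V)
    (a : G.neighborSet x) : (R.next x)^[G.degree x] a = a := by
  have h := Function.iterate_minimalPeriod (f := R.next x) (x := a)
  rwa [minimalPeriod_next] at h

theorem degree_le_two_of_isSucc [Fintype V] [DecidableRel G.Adj] {R : RotationSystem G} {v a b : V}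
    (h : R.IsSucc v a b) (h' : R.IsSucc v b a) : G.degree v ≤ 2 := by
  obtain ⟨ha, rfl⟩ := h
  obtain ⟨hb, h2⟩ := h'
  rw [← R.minimalPeriod_next v ⟨a, ha⟩]
  exact Function.IsPeriodicPt.minimalPeriod_le (by norm_num) (Subtype.ext h2)

/-- The region between the path `v x w` and a neighbor `p` of `v` and `w` is a face, or consists
of the two triangles at an edge from `x` to `p`. -/
def FaceSide (R : RotationSystem G) (v x w p : V) : Prop :=
  R.IsFace4 p v x w ∨ (R.IsFace3 p v x ∧ R.IsFace3 x w p)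

theorem FaceSide.succ_left {R : RotationSystem G} {v x w p : V} (h : R.FaceSide v x w p) :
    R.IsSucc v p x := by
  rcases h with h | h
  · exact h.1
  · exact h.1.1

theorem FaceSide.succ_right {R : RotationSystem G} {v x w p : V} (h : R.FaceSide v x w p) :
    R.IsSucc w x p := by
  rcases h with h | h
  · exact h.2.2.1
  · exact h.2.1

theorem FaceSide.adj {R : RotationSystem G} {v x w p : V} (h : R.FaceSide v x w p) :
    G.Adj x v ∧ G.Adj x w := by
  obtain ⟨h1, h2⟩ := h.succ_left
  obtain ⟨h3, -⟩ := h.succ_right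
  refine ⟨?_, h3.symm⟩
  have := (R.next v ⟨p, h1⟩).2
  rw [h2] at this
  exact SimpleGraph.Adj.symm this

/-- The dart to `x` from a neighbor of `x`. -/
def dartIn (x : V) (a : G.neighborSet x) : G.Dart := ⟨(a, x), SimpleGraph.Adj.symm a.2⟩

theorem faceSide_of_faceLen_eq_four {R : RotationSystem G} {x : V} {a : G.neighborSet x}
    (h : R.faceLen (dartIn x a) = 4) : ∃ p, R.FaceSide a x (R.next x a) p :=
  ⟨_, Or.inl (isFace4_of_faceLen h)⟩

theorem faceSide_of_faceLen_eq_three {R : RotationSystem G} {x : V} {a : G.neighborSet x}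
    (h : R.faceLen (dartIn x a) = 3) (h' : R.faceLen (dartIn x (R.next x a)) = 3) :
    R.FaceSide a x (R.next x (R.next x a)) (R.next x a) := by
  have h1 : R.IsFace3 (R.next x a) a x := isFace3_of_faceLen h
  have h2 : R.IsFace3 (R.next x (R.next x a)) (R.next x a) x := isFace3_of_faceLen h'
  exact Or.inr ⟨h1, h2.2.2, h2.1, h2.2.1⟩

variable [Fintype V] [DecidableRel G.Adj]

/-- A bunch of length one, flanked by `p` and `p'`, is enough. The flanks differ from each other and
from `x` because otherwise the rotation at `v` would close up after at most two steps. -/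
theorem inBunchOf_of_faceSide {R : RotationSystem G} {v w x p p' : V} (hv : IsBig G v)
    (hw : IsBig G w) (hvw : v ≠ w) (hx : G.degree x ≤ 4) (h : R.FaceSide v x w p)
    (h' : R.FaceSide w x v p') : InBunchOf R v x := by
  have hv2 : 2 < G.degree v := lt_of_lt_of_le (by norm_num) hv
  have hpx : p ≠ x := by
    rintro rfl
    exact hv2.not_ge (degree_le_two_of_isSucc h.succ_left h.succ_left)
  have hpx' : p' ≠ x := by
    rintro rfl
    exact hv2.not_ge (degree_le_two_of_isSucc h'.succ_right h'.succ_right)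
  have hpp : p ≠ p' := by
    rintro rfl
    exact hv2.not_ge (degree_le_two_of_isSucc h.succ_left h'.succ_right)
  refine ⟨w, 1, fun i => if i = 0 then p else if i = 1 then x else p', ?_, 1, le_rfl, le_rfl, rfl⟩
  refine ⟨le_rfl, hvw, hv, hw, ?_, ?_, ?_, ?_, ?_⟩
  · intro i hi j hj hij
    have hi' := hi.2
    have hj' := hj.2
    clear hi hj
    interval_cases i <;> interval_cases j <;> simp_all [eq_comm]
  · intro i hi
    interval_cases i
    · exact h.succ_left
    · exact h'.succ_right
  · intro i hi
    interval_cases i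
    · exact h.succ_right
    · exact h'.succ_left
  · intro i h1 h2
    obtain rfl : i = 1 := by omega
    exact hx
  · intro i hi
    interval_cases i
    · exact h
    · rcases h' with h' | h'
      · exact Or.inl ⟨h'.2.2.1, h'.2.2.2, h'.1, h'.2.1⟩
      · exact Or.inr ⟨h'.2, h'.1⟩

/-- Only the two sides of `x` itself matter: each vertex of a bunch is already a bunch of length
one. -/
theorem _root_.PlaneGraph.InBunchOf.exists_faceSide {R : RotationSystem G} {v x : V}
    (h : InBunchOf R v x) :
    ∃ w p p', IsBig G v ∧ IsBig G w ∧ v ≠ w ∧ G.degree x ≤ 4 ∧ R.FaceSide v x w p ∧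
      R.FaceSide w x v p' := by
  obtain ⟨w, t, y, hb, i, h1, h2, rfl⟩ := h
  obtain ⟨j, rfl⟩ : ∃ j, i = j + 1 := ⟨i - 1, by omega⟩
  refine ⟨w, y j, y (j + 2), hb.big_left, hb.big_right, hb.parents_ne,
    hb.degree_le _ h1 h2, hb.not_separating j (by omega), ?_⟩
  rcases hb.not_separating (j + 1) h2 with h | h
  · exact Or.inl ⟨h.2.2.1, h.2.2.2, h.1, h.2.1⟩
  · exact Or.inr ⟨h.2, h.1⟩

end RotationSystem
end PlaneGraph

/-! ### Charge received at vertices of degree 2, 3 and 4 -/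

namespace PlaneGraph

/-- The charge of a corner at a vertex that is not big, in a face of length `l`, where `p` and `r`
say whether the two neighbors along the face are big. -/
def cornerShare (l : ℕ) (p r : Bool) : ℤ :=
  faceShare l p false r + if l = 3 ∧ p = true ∧ r = true then 4 else 0

theorem cornerShare_nonneg (l : ℕ) (p r : Bool) : 0 ≤ cornerShare l p r := by
  unfold cornerShare faceShare; split_ifs <;> simp

theorem two_le_cornerShare {l : ℕ} {p r : Bool} (hl : 3 < l) (h : p = true ∨ r = true) :
    2 ≤ cornerShare l p r := by
  unfold cornerShare faceShare
  rcases h with rfl | rfl <;> simp <;> split_ifs <;> omega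

theorem two_le_cornerShare_true {l : ℕ} (hl : 3 ≤ l) : 2 ≤ cornerShare l true true := by
  unfold cornerShare faceShare; simp; split_ifs <;> omega

theorem four_le_cornerShare_true {l : ℕ} (hl : 3 ≤ l) (h4 : l ≠ 4) :
    4 ≤ cornerShare l true true := by
  unfold cornerShare faceShare; simp; split_ifs <;> omega

/-- Both corners lie between two big vertices and get at least 2, or 4 off a 4-face. Two 4-faces
would form a bunch. -/
theorem four_le_corners_two {l₀ l₁ : ℕ} (h₀ : 3 ≤ l₀) (h₁ : 3 ≤ l₁) {p₀ p₁ : Bool}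
    (hb : 2 ≤ ((if p₀ = true then 1 else 0) + (if p₁ = true then 1 else 0) : ℤ))
    (h33 : p₀ = true → p₁ = true → ¬ (l₀ = 3 ∧ l₁ = 3))
    (h44 : p₀ = true → p₁ = true → ¬ (l₀ = 4 ∧ l₁ = 4)) :
    6 ≤ cornerShare l₀ p₀ p₁ + cornerShare l₁ p₁ p₀ := by
  cases p₀ <;> cases p₁ <;> simp at hb h33 h44
  have a₀ := two_le_cornerShare_true h₀
  have a₁ := two_le_cornerShare_true h₁
  by_cases h : l₀ = 4
  · have := four_le_cornerShare_true h₁ (h44 h)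
    omega
  · have := four_le_cornerShare_true h₀ h
    omega

/-- With two big neighbors the corner between them gets 4, unless its face has length 4. In that
case another 2 comes from a neighboring face that is not a triangle; lengths 4, 3, 3 are the bunch
pattern. -/
theorem le_corners_three {l₀ l₁ l₂ : ℕ} (h₀ : 3 ≤ l₀) (h₁ : 3 ≤ l₁) (h₂ : 3 ≤ l₂)
    {p₀ p₁ p₂ : Bool}
    (hb : 2 ≤ ((if p₀ = true then 1 else 0) + (if p₁ = true then 1 else 0) +
      (if p₂ = true then 1 else 0) : ℤ))
    (h01 : p₀ = true → p₁ = true → ¬ (l₀ = 4 ∧ l₁ = 3 ∧ l₂ = 3))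
    (h12 : p₁ = true → p₂ = true → ¬ (l₁ = 4 ∧ l₂ = 3 ∧ l₀ = 3))
    (h20 : p₂ = true → p₀ = true → ¬ (l₂ = 4 ∧ l₀ = 3 ∧ l₁ = 3)) :
    6 - ((if p₀ = true then 1 else 0) + (if p₁ = true then 1 else 0) +
      (if p₂ = true then 1 else 0) : ℤ) ≤
      cornerShare l₀ p₀ p₁ + cornerShare l₁ p₁ p₂ + cornerShare l₂ p₂ p₀ := by
  have key : ∀ {l l' l'' : ℕ}, 3 ≤ l → 3 ≤ l' → 3 ≤ l'' → ¬ (l = 4 ∧ l' = 3 ∧ l'' = 3) →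
      4 ≤ cornerShare l true true + cornerShare l' true false + cornerShare l'' false true := by
    intro l l' l'' h h' h'' hn
    have a := two_le_cornerShare_true h
    have b := cornerShare_nonneg l' true false
    have c := cornerShare_nonneg l'' false true
    by_cases h4 : l = 4
    · by_cases h3 : l' = 3
      · have := two_le_cornerShare (l := l'') (p := false) (r := true) (by omega) (Or.inr rfl)
        omega
      · have := two_le_cornerShare (l := l') (p := true) (r := false) (by omega) (Or.inl rfl)
        omega
    · have := four_le_cornerShare_true h h4
      omega
  cases p₀ <;> cases p₁ <;> cases p₂ <;> simp at hb h01 h12 h20 ⊢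
  · have := key h₁ h₂ h₀ (by omega)
    omega
  · have := key h₂ h₀ h₁ (by omega)
    omega
  · have := key h₀ h₁ h₂ (by omega)
    omega
  · have a₀ := two_le_cornerShare_true h₀
    have a₁ := two_le_cornerShare_true h₁
    have a₂ := two_le_cornerShare_true h₂
    omega

/-- Two consecutive big neighbors give 2 at once. If two big neighbors are opposite, every corner
touches one of them, and a single face that is not a triangle suffices; four triangles are the bunch
pattern. -/
theorem le_corners_four {l₀ l₁ l₂ l₃ : ℕ} (h₀ : 3 ≤ l₀) (h₁ : 3 ≤ l₁) (h₂ : 3 ≤ l₂) (h₃ : 3 ≤ l₃)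
    {p₀ p₁ p₂ p₃ : Bool}
    (hb : 2 ≤ ((if p₀ = true then 1 else 0) + (if p₁ = true then 1 else 0) +
      (if p₂ = true then 1 else 0) + (if p₃ = true then 1 else 0) : ℤ))
    (h02 : p₀ = true → p₂ = true → ¬ (l₀ = 3 ∧ l₁ = 3 ∧ l₂ = 3 ∧ l₃ = 3))
    (h13 : p₁ = true → p₃ = true → ¬ (l₀ = 3 ∧ l₁ = 3 ∧ l₂ = 3 ∧ l₃ = 3)) :
    4 - ((if p₀ = true then 1 else 0) + (if p₁ = true then 1 else 0) +
      (if p₂ = true then 1 else 0) + (if p₃ = true then 1 else 0) : ℤ) ≤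
      cornerShare l₀ p₀ p₁ + cornerShare l₁ p₁ p₂ + cornerShare l₂ p₂ p₃ +
        cornerShare l₃ p₃ p₀ := by
  have n₀ := cornerShare_nonneg l₀ p₀ p₁
  have n₁ := cornerShare_nonneg l₁ p₁ p₂
  have n₂ := cornerShare_nonneg l₂ p₂ p₃
  have n₃ := cornerShare_nonneg l₃ p₃ p₀
  have t₀ := two_le_cornerShare_true h₀
  have t₁ := two_le_cornerShare_true h₁
  have t₂ := two_le_cornerShare_true h₂
  have t₃ := two_le_cornerShare_true h₃
  by_cases c₀ : p₀ = true ∧ p₁ = true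
  · obtain ⟨rfl, rfl⟩ := c₀
    split_ifs at * <;> omega
  by_cases c₁ : p₁ = true ∧ p₂ = true
  · obtain ⟨rfl, rfl⟩ := c₁
    split_ifs at * <;> omega
  by_cases c₂ : p₂ = true ∧ p₃ = true
  · obtain ⟨rfl, rfl⟩ := c₂
    split_ifs at * <;> omega
  by_cases c₃ : p₃ = true ∧ p₀ = true
  · obtain ⟨rfl, rfl⟩ := c₃
    split_ifs at * <;> omega
  have u₀ : 3 < l₀ → p₀ = true ∨ p₁ = true → 2 ≤ cornerShare l₀ p₀ p₁ := two_le_cornerShare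
  have u₁ : 3 < l₁ → p₁ = true ∨ p₂ = true → 2 ≤ cornerShare l₁ p₁ p₂ := two_le_cornerShare
  have u₂ : 3 < l₂ → p₂ = true ∨ p₃ = true → 2 ≤ cornerShare l₂ p₂ p₃ := two_le_cornerShare
  have u₃ : 3 < l₃ → p₃ = true ∨ p₀ = true → 2 ≤ cornerShare l₃ p₃ p₀ := two_le_cornerShare
  clear t₀ t₁ t₂ t₃
  split_ifs at * <;> simp_all <;> omega

namespace RotationSystem

variable {V : Type*} {G : SimpleGraph V}

/-- The charge of the corner at `x` between `a` and the next neighbor. -/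
noncomputable def share (R : RotationSystem G) (β : V → Bool) (x : V) (a : G.neighborSet x) : ℤ :=
  cornerShare (R.faceLen (dartIn x a)) (β a) (β (R.next x a))

variable {R : RotationSystem G} {β : V → Bool}

theorem share_nonneg (x : V) (a : G.neighborSet x) : 0 ≤ R.share β x a :=
  cornerShare_nonneg _ _ _

variable [Fintype V] [DecidableRel G.Adj]

theorem inBunchOf_of_opposite (hβ : ∀ v, β v = true ↔ IsBig G v) {x : V} (hx : G.degree x ≤ 4)
    {a c : G.neighborSet x} {p p' : V} (hac : a ≠ c) (ha : β a = true) (hc : β c = true)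
    (h : R.FaceSide a x c p) (h' : R.FaceSide c x a p') : InBunchOf R a x :=
  inBunchOf_of_faceSide ((hβ _).mp ha) ((hβ _).mp hc) (fun h => hac (Subtype.ext h)) hx h h'

/-- A vertex of degree at most 5 with two big neighbors that is in no bunch receives enough
charge. -/
theorem le_sum_share_of_not_inBunchOf (hβ : ∀ v, β v = true ↔ IsBig G v)
    (hlen : ∀ d, 3 ≤ R.faceLen d) {x : V} (h2 : 2 ≤ G.degree x)
    (hb : 2 ≤ ∑ a : G.neighborSet x, (if β a = true then 1 else 0 : ℤ))
    (hno : ∀ v, ¬ InBunchOf R v x) :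
    12 - 2 * (G.degree x : ℤ) - ∑ a : G.neighborSet x, (if β a = true then 1 else 0 : ℤ) ≤
      ∑ a, R.share β x a := by
  have hne : Nonempty (G.neighborSet x) := by
    rw [← Fintype.card_pos_iff, SimpleGraph.card_neighborSet_eq_degree]; omega
  obtain ⟨a⟩ := hne
  have hper := R.iterate_next_degree x a
  have hinj : ∀ i, 0 < i → i < G.degree x → (R.next x)^[i] a ≠ a := by
    intro i h0 hi h
    have : Function.minimalPeriod (R.next x) a ≤ i := Function.IsPeriodicPt.minimalPeriod_le h0 h
    rw [R.minimalPeriod_next x a] at this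
    omega
  rcases Nat.lt_or_ge 4 (G.degree x) with h5 | h4
  -- In degree at least 5 the required amount is not positive, as there are two big neighbors.
  · have := Finset.sum_nonneg fun a (_ : a ∈ Finset.univ) => R.share_nonneg (β := β) x a
    have h5' : (5 : ℤ) ≤ G.degree x := by exact_mod_cast h5
    linarith
  rw [R.sum_neighborSet x a] at hb ⊢
  rw [R.sum_neighborSet x a (fun a => R.share β x a)]
  unfold share
  obtain hk | hk | hk : G.degree x = 2 ∨ G.degree x = 3 ∨ G.degree x = 4 := by omega
  · rw [hk] at hper hinj
    have e1 : R.next x (R.next x a) = a := hper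
    have d1 : R.next x a ≠ a := hinj 1 (by norm_num) (by norm_num)
    simp only [hk, Finset.sum_range_succ, Finset.sum_range_zero, zero_add,
      Function.iterate_succ_apply', Function.iterate_zero, id, e1] at hb ⊢
    refine le_trans ?_ (four_le_corners_two (hlen _) (hlen _) hb ?_ ?_)
    · push_cast; linarith
    · rintro ha - ⟨l0, l1⟩
      have f0 : R.IsFace3 (R.next x a) a x := isFace3_of_faceLen l0
      have f1 : R.IsFace3 (R.next x (R.next x a)) (R.next x a) x := isFace3_of_faceLen l1
      rw [e1] at f1
      have := degree_le_two_of_isSucc f0.1 f1.2.2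
      have hbig : 8680 ≤ G.degree a := (hβ _).mp ha
      omega
    · rintro ha hc ⟨l0, l1⟩
      obtain ⟨p, hp⟩ := faceSide_of_faceLen_eq_four l0
      obtain ⟨p', hp'⟩ := faceSide_of_faceLen_eq_four l1
      rw [e1] at hp'
      exact hno _ (inBunchOf_of_opposite hβ h4 d1.symm ha hc hp hp')
  · rw [hk] at hper hinj
    have e2 : R.next x (R.next x (R.next x a)) = a := hper
    have d1 : R.next x a ≠ a := hinj 1 (by norm_num) (by norm_num)
    have d2 : R.next x (R.next x a) ≠ a := hinj 2 (by norm_num) (by norm_num)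
    have key : ∀ b : G.neighborSet x, R.next x (R.next x (R.next x b)) = b → b ≠ R.next x b →
        β b = true → β (R.next x b) = true → ¬ (R.faceLen (dartIn x b) = 4 ∧
          R.faceLen (dartIn x (R.next x b)) = 3 ∧
          R.faceLen (dartIn x (R.next x (R.next x b))) = 3) := by
      rintro b e hbn hb hc ⟨l0, l1, l2⟩
      obtain ⟨p, hp⟩ := faceSide_of_faceLen_eq_four l0
      have hp' := faceSide_of_faceLen_eq_three l1 l2
      rw [e] at hp'
      exact hno _ (inBunchOf_of_opposite hβ h4 hbn hb hc hp hp')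
    simp only [hk, Finset.sum_range_succ, Finset.sum_range_zero, zero_add,
      Function.iterate_succ_apply', Function.iterate_zero, id, e2] at hb ⊢
    have k0 := key a e2 d1.symm
    have k1 := key (R.next x a) (by rw [e2]) (fun h => d1 ((R.next x).injective h).symm)
    have k2 := key (R.next x (R.next x a)) (by rw [e2]) (by rw [e2]; exact d2)
    rw [e2] at k1 k2
    rw [show (12 - 2 * ((3 : ℕ) : ℤ)) = 6 by norm_num]
    exact le_corners_three (hlen _) (hlen _) (hlen _) hb k0 k1 k2
  · rw [hk] at hper hinj
    have e3 : R.next x (R.next x (R.next x (R.next x a))) = a := hper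
    have d2 : R.next x (R.next x a) ≠ a := hinj 2 (by norm_num) (by norm_num)
    simp only [hk, Finset.sum_range_succ, Finset.sum_range_zero, zero_add,
      Function.iterate_succ_apply', Function.iterate_zero, id, e3] at hb ⊢
    rw [show (12 - 2 * ((4 : ℕ) : ℤ)) = 4 by norm_num]
    refine le_corners_four (hlen _) (hlen _) (hlen _) (hlen _) hb ?_ ?_
    · rintro ha hc ⟨l0, l1, l2, l3⟩
      have hp := faceSide_of_faceLen_eq_three l0 l1
      have hp' := faceSide_of_faceLen_eq_three l2 l3
      rw [e3] at hp'
      exact hno _ (inBunchOf_of_opposite hβ h4 d2.symm ha hc hp hp')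
    · rintro ha hc ⟨l0, l1, l2, l3⟩
      have hp := faceSide_of_faceLen_eq_three l1 l2
      have hp' := faceSide_of_faceLen_eq_three l3 (by rw [e3]; exact l0)
      rw [e3] at hp'
      exact hno _ (inBunchOf_of_opposite hβ h4
        (fun h => d2 ((R.next x).injective h).symm) ha hc hp hp')

/-- A vertex in a bunch receives enough charge. -/
theorem le_sum_share_of_inBunchOf (hβ : ∀ v, β v = true ↔ IsBig G v)
    (hlen : ∀ d, 3 ≤ R.faceLen d) {v x : V} (h2 : 2 ≤ G.degree x) (h : InBunchOf R v x) :
    8 - 2 * (G.degree x : ℤ) ≤ ∑ a, R.share β x a := by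
  classical
  obtain ⟨w, p, p', hv, hw, hvw, h4, hs, hs'⟩ := h.exists_faceSide
  obtain ⟨hxv, hxw⟩ := hs.adj
  let a : G.neighborSet x := ⟨v, hxv⟩
  let c : G.neighborSet x := ⟨w, hxw⟩
  have hac : a ≠ c := fun h => hvw (congrArg Subtype.val h)
  have hnn := fun b => R.share_nonneg (β := β) x b
  have hfour : ∀ {u z q : V} (hxu : G.Adj x u), IsBig G u → R.IsFace4 q u x z →
      2 ≤ R.share β x ⟨u, hxu⟩ := by
    intro u z q hxu hu hf
    have : R.faceLen (dartIn x ⟨u, hxu⟩) = 4 := hf.faceLen_eq _ (hlen _)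
    unfold share
    exact two_le_cornerShare (by omega) (Or.inl ((hβ _).mpr hu))
  have hthree : ∀ {u z q : V} (hxu : G.Adj x u) (hxz : G.Adj x z),
      R.IsFace3 q u x ∧ R.IsFace3 x z q → R.next x (R.next x ⟨u, hxu⟩) = ⟨z, hxz⟩ := by
    intro u z q hxu hxz hf
    obtain ⟨h1, h1'⟩ := hf.1.2.1
    obtain ⟨h2, h2'⟩ := hf.2.2.2
    have e1 : R.next x ⟨u, hxu⟩ = ⟨q, h2⟩ := Subtype.ext h1'
    rw [e1]
    exact Subtype.ext h2'
  have hmin := R.minimalPeriod_next x a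
  have hone : ∀ b, 2 ≤ R.share β x b → 2 ≤ ∑ a, R.share β x a := fun b hb =>
    hb.trans (Finset.single_le_sum (fun b _ => hnn b) (Finset.mem_univ b))
  obtain hk | hk | hk : G.degree x = 2 ∨ G.degree x = 3 ∨ G.degree x = 4 := by omega
  · have hper := R.iterate_next_degree x
    rw [hk] at hper
    -- Two triangles on one side would make two rotation steps lead from `v` to `w`, but in degree 2
    -- they return to `v`. So both sides are 4-faces, each worth 2.
    have hl := hs.resolve_right fun hf => hac ((hper a).symm.trans (hthree hxv hxw hf))
    have hr := hs'.resolve_right fun hf => hac ((hthree hxw hxv hf).symm.trans (hper c))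
    have h1 := hfour hxv hv hl
    have h2 := hfour hxw hw hr
    have h3 : ∑ b ∈ ({a, c} : Finset (G.neighborSet x)), R.share β x b ≤ ∑ a, R.share β x a :=
      Finset.sum_le_sum_of_subset_of_nonneg (Finset.subset_univ _) fun b _ _ => hnn b
    rw [Finset.sum_pair hac] at h3
    rw [hk]; push_cast; linarith
  · have h5 : 2 ≤ ∑ a, R.share β x a := by
      rcases hs with hl | hl
      · exact hone _ (hfour hxv hv hl)
      rcases hs' with hr | hr
      · exact hone _ (hfour hxw hw hr)
      exfalso
      -- Two triangles on both sides would need four distinct neighbors of `x`; in degree 3 the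
      -- rotation would get a fixed point.
      have e1 : R.next x (R.next x a) = c := hthree hxv hxw hl
      have e2 : R.next x (R.next x c) = a := hthree hxw hxv hr
      have hper := R.iterate_next_degree x a
      rw [hk] at hper
      have e3 : R.next x (R.next x (R.next x a)) = a := hper
      rw [e1] at e3
      rw [e3] at e2
      rw [Function.minimalPeriod_eq_one_iff_isFixedPt.mpr e2] at hmin
      omega
    rw [hk]; push_cast; linarith
  · rw [hk]
    have := Finset.sum_nonneg fun b (_ : b ∈ Finset.univ) => hnn b
    push_cast; linarith

end RotationSystem
end PlaneGraph

/-! ### Consequences of the absence of the configurations, and the charge balance at each vertex -/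

namespace PlaneGraph

variable {V : Type*} {G : SimpleGraph V} [Fintype V] [DecidableRel G.Adj]

theorem sum_dart_eq_sum_snd {M : Type*} [AddCommMonoid M] (φ : G.Dart → M) :
    ∑ d, φ d = ∑ x, ∑ a : G.neighborSet x, φ (RotationSystem.dartIn x a) := by
  rw [Finset.sum_sigma']
  symm
  refine Finset.sum_bij' (fun p _ => RotationSystem.dartIn p.1 p.2)
    (fun d _ => ⟨d.snd, d.fst, d.adj.symm⟩) ?_ ?_ ?_ ?_ ?_ <;> simp [RotationSystem.dartIn]

theorem sum_dart_eq_sum_fst {M : Type*} [AddCommMonoid M] (φ : V → V → M) :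
    ∑ d : G.Dart, φ d.fst d.snd = ∑ v, ∑ u : G.neighborSet v, φ v u := by
  rw [Finset.sum_sigma']
  symm
  refine Finset.sum_bij' (fun p _ => RotationSystem.dartOut p.1 p.2)
    (fun d _ => ⟨d.fst, d.snd, d.adj⟩) ?_ ?_ ?_ ?_ ?_ <;> simp [RotationSystem.dartOut]

theorem sum_neighborSet_const (x : V) (c : ℤ) : ∑ _a : G.neighborSet x, c = c * G.degree x := by
  rw [Finset.sum_const, Finset.card_univ, SimpleGraph.card_neighborSet_eq_degree, nsmul_eq_mul,
    mul_comm]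

section RC1

variable {k : ℕ}

theorem two_le_degree_of_not_hasRC1 (h : ¬ HasRC1 G (max G.maxDegree k)) (v : V) :
    2 ≤ G.degree v := by
  by_contra! hlt
  refine h ⟨v, le_trans ?_ (le_max_left _ _)⟩
  calc ∑ w ∈ G.neighborFinset v, G.degree w
      ≤ ∑ w ∈ G.neighborFinset v, G.maxDegree :=
        Finset.sum_le_sum fun w _ => G.degree_le_maxDegree w
    _ = G.degree v * G.maxDegree := by
        rw [Finset.sum_const, SimpleGraph.card_neighborFinset_eq_degree, smul_eq_mul]
    _ ≤ 1 * G.maxDegree := Nat.mul_le_mul_right _ (by omega)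
    _ = G.maxDegree := one_mul _

theorem exists_isBig_of_not_hasRC1 (h : ¬ HasRC1 G (max k (5 * 8680))) {v : V}
    (hv : G.degree v ≤ 5) : ∃ w, G.Adj v w ∧ IsBig G w := by
  by_contra! hcon
  refine h ⟨v, le_trans ?_ (le_max_right _ _)⟩
  calc ∑ w ∈ G.neighborFinset v, G.degree w
      ≤ ∑ w ∈ G.neighborFinset v, 8680 := by
        refine Finset.sum_le_sum fun w hw => ?_
        have := hcon w ((G.mem_neighborFinset v w).mp hw)
        unfold IsBig at this
        omega
    _ = G.degree v * 8680 := by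
        rw [Finset.sum_const, SimpleGraph.card_neighborFinset_eq_degree, smul_eq_mul]
    _ ≤ 5 * 8680 := Nat.mul_le_mul_right _ hv

/-- The neighbor degrees of `x` sum to more than `Δ`, and at most four neighbors besides `v`
contribute, each less than 8680. So only very big vertices face sole demands, and these need only
the stronger bound excluded by (RC4). -/
theorem isVeryBig_of_mem_soleBigNeighborSet (h : ¬ HasRC1 G (max G.maxDegree k)) {v x : V}
    (hx : x ∈ soleBigNeighborSet G v) : IsVeryBig G v := by
  classical
  obtain ⟨hd, hxv, -, huniq⟩ := hx
  have hsum : G.maxDegree < ∑ w ∈ G.neighborFinset x, G.degree w := by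
    by_contra! hle
    exact h ⟨x, hle.trans (le_max_left _ _)⟩
  have hmem : v ∈ G.neighborFinset x := (G.mem_neighborFinset x v).mpr hxv
  rw [← Finset.add_sum_erase _ _ hmem] at hsum
  have hrest : ∑ w ∈ (G.neighborFinset x).erase v, G.degree w ≤ 4 * 8680 := by
    calc ∑ w ∈ (G.neighborFinset x).erase v, G.degree w
        ≤ ∑ w ∈ (G.neighborFinset x).erase v, 8680 := by
          refine Finset.sum_le_sum fun w hw => ?_
          have hw' := Finset.mem_erase.mp hw
          have : ¬ 8680 ≤ G.degree w := fun hb =>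
            hw'.1 (huniq w ((G.mem_neighborFinset x w).mp hw'.2) hb)
          omega
      _ = (G.degree x - 1) * 8680 := by
          rw [Finset.sum_const, Finset.card_erase_of_mem hmem,
            SimpleGraph.card_neighborFinset_eq_degree, smul_eq_mul]
      _ ≤ 4 * 8680 := Nat.mul_le_mul_right _ (by omega)
  unfold IsVeryBig
  omega

end RC1

open Classical in
/-- The weight of the neighbor `u` of `v` in `n₅(v) + 2 n₆(v)`. -/
noncomputable def weight (R : RotationSystem G) (v u : V) : ℤ :=
  if InBunchOf R v u then 0 else if G.degree u ≤ 5 then 1 else 2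

open Classical in
/-- The extra demand of `u` on `v`, if `v` is its unique big neighbor. -/
noncomputable def soleDemand (G : SimpleGraph V) [DecidableRel G.Adj] (v u : V) : ℤ :=
  if u ∈ soleBigNeighborSet G v then 11 - 2 * (G.degree u : ℤ) else 0

theorem InBunchOf.degree_le {R : RotationSystem G} {v u : V} (h : InBunchOf R v u) :
    G.degree u ≤ 4 := by
  obtain ⟨w, p, p', -, -, -, h4, -⟩ := h.exists_faceSide
  exact h4

theorem InBunchOf.adj {R : RotationSystem G} {v u : V} (h : InBunchOf R v u) : G.Adj v u := by
  obtain ⟨w, p, p', -, -, -, -, hs, -⟩ := h.exists_faceSide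
  exact hs.adj.1.symm

theorem InBunchOf.exists_other {R : RotationSystem G} {v u : V} (h : InBunchOf R v u) :
    IsBig G v ∧ ∃ w, IsBig G w ∧ v ≠ w ∧ InBunchOf R w u := by
  obtain ⟨w, p, p', hv, hw, hvw, h4, hs, hs'⟩ := h.exists_faceSide
  exact ⟨hv, w, hw, hvw, RotationSystem.inBunchOf_of_faceSide hw hv hvw.symm h4 hs' hs⟩

theorem weight_le_one {R : RotationSystem G} {v u : V} (hu : G.degree u ≤ 5) :
    weight R v u ≤ 1 := by
  unfold weight; split_ifs <;> simp

theorem weight_of_six_le {R : RotationSystem G} {v u : V} (hu : 6 ≤ G.degree u) :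
    weight R v u = 2 := by
  unfold weight
  rw [if_neg fun h => absurd h.degree_le (by omega), if_neg (by omega)]

theorem soleDemand_nonneg (v u : V) : 0 ≤ soleDemand G v u := by
  unfold soleDemand
  split_ifs with h
  · have := h.1
    omega
  · exact le_rfl

theorem soleDemand_of_six_le {v u : V} (hu : 6 ≤ G.degree u) : soleDemand G v u = 0 := by
  unfold soleDemand
  rw [if_neg fun h => absurd h.1 (by omega)]

theorem sum_ite_eq_ncard {v : V} (p : V → Prop) [DecidablePred p] (hp : ∀ u, p u → G.Adj v u) :
    ∑ u : G.neighborSet v, (if p u then 1 else 0 : ℤ) = ({u | p u}.ncard : ℤ) := by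
  classical
  refine (Finset.sum_subtype (G.neighborFinset v) (p := fun u => u ∈ G.neighborSet v)
    (fun u => G.mem_neighborFinset v u) (fun u => (if p u then 1 else 0 : ℤ))).symm.trans ?_
  rw [Finset.sum_boole, Set.ncard_eq_toFinset_card']
  congr 2
  ext u
  simp only [Finset.mem_filter, SimpleGraph.mem_neighborFinset, Set.mem_toFinset, Set.mem_ofPred_eq]
  exact ⟨fun h => h.2, fun h => ⟨hp u h, h⟩⟩

theorem sum_weight (R : RotationSystem G) (v : V) :
    ∑ u : G.neighborSet v, weight R v u = nFive R v + 2 * nSix R v := by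
  classical
  unfold nFive nSix
  rw [← sum_ite_eq_ncard (G := G) (v := v) _ fun u hu => hu.1,
    ← sum_ite_eq_ncard (G := G) (v := v) _ fun u hu => hu.1, Finset.mul_sum,
    ← Finset.sum_add_distrib]
  refine Finset.sum_congr rfl fun u _ => ?_
  have hu : G.Adj v u := u.2
  unfold weight
  by_cases h1 : InBunchOf R v u
  · simp [h1]
  · by_cases h2 : G.degree u ≤ 5
    · have h3 : ¬ 6 ≤ G.degree (u : V) := by omega
      simp [h1, h2, h3, hu]
    · have h3 : 6 ≤ G.degree (u : V) := by omega
      simp [h1, h2, h3, hu]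

/-- The demands 7, 5, 3, 1 for degrees 2, 3, 4, 5 are split into layers of heights 2, 2, 2, 1. Since
`d(v) ≤ Δ`, the absence of (RC2) bounds the layers, giving `2 (8888 + 17654 + 26400) + 35136 =
141020`. -/
theorem sum_soleDemand_le (hdeg : ∀ v, 2 ≤ G.degree v) (h : ¬ HasRC2 G) {v : V}
    (hv : IsBig G v) : ∑ u : G.neighborSet v, soleDemand G v u ≤ 141020 := by
  classical
  have hle := G.degree_le_maxDegree v
  have hcon := not_exists.mp h v
  simp only [hv, true_and, not_or, not_le] at hcon
  obtain ⟨c2, c3, c4, c5⟩ := hcon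
  have hadj : ∀ (q : V → Prop) (u : V), (u ∈ soleBigNeighborSet G v ∧ q u) → G.Adj v u :=
    fun q u hu => hu.1.2.1.symm
  have e2 := sum_ite_eq_ncard (G := G) (v := v) _ (hadj fun u => G.degree u = 2)
  have e3 := sum_ite_eq_ncard (G := G) (v := v) _ (hadj fun u => G.degree u ≤ 3)
  have e4 := sum_ite_eq_ncard (G := G) (v := v) _ (hadj fun u => G.degree u ≤ 4)
  have e5 := sum_ite_eq_ncard (G := G) (v := v) _ (hadj fun u => G.degree u ≤ 5)
  rw [← e2] at c2
  rw [← e3] at c3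
  rw [← e4] at c4
  rw [← e5] at c5
  have hsum : ∑ u : G.neighborSet v, soleDemand G v u ≤
      ∑ u : G.neighborSet v,
        (2 * (if (u : V) ∈ soleBigNeighborSet G v ∧ G.degree (u : V) = 2 then 1 else 0 : ℤ) +
        2 * (if (u : V) ∈ soleBigNeighborSet G v ∧ G.degree (u : V) ≤ 3 then 1 else 0 : ℤ) +
        2 * (if (u : V) ∈ soleBigNeighborSet G v ∧ G.degree (u : V) ≤ 4 then 1 else 0 : ℤ) +
        (if (u : V) ∈ soleBigNeighborSet G v ∧ G.degree (u : V) ≤ 5 then 1 else 0 : ℤ)) := by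
    refine Finset.sum_le_sum fun u _ => ?_
    have := hdeg u
    unfold soleDemand
    by_cases hu : (u : V) ∈ soleBigNeighborSet G v
    · simp only [hu, true_and, if_true]
      split_ifs <;> omega
    · simp [hu]
  simp only [Finset.sum_add_distrib, ← Finset.mul_sum] at hsum
  omega

/-- In the absence of (RC1)–(RC4), the weight at a big vertex covers the extra demands on it. -/
theorem le_sum_weight_sub_soleDemand {R : RotationSystem G}
    (h1 : ¬ HasRC1 G (max G.maxDegree (5 * 8680))) (h2 : ¬ HasRC2 G) (h3 : ¬ HasRC3 R)
    (h4 : ¬ HasRC4 R) {v : V} (hv : IsBig G v) :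
    36 ≤ ∑ u : G.neighborSet v, (weight R v u - soleDemand G v u) := by
  rw [Finset.sum_sub_distrib, sum_weight]
  by_cases hvb : IsVeryBig G v
  · have hw : ¬ nFive R v + 2 * nSix R v ≤ 141415 := fun hle => h4 ⟨v, hvb, hle⟩
    have hs := sum_soleDemand_le (two_le_degree_of_not_hasRC1 h1) h2 hv
    omega
  · have hw : ¬ nFive R v + 2 * nSix R v ≤ 35 := fun hle => h3 ⟨v, hv, hle⟩
    have hs : ∑ u : G.neighborSet v, soleDemand G v u = 0 := by
      refine Finset.sum_eq_zero fun u _ => ?_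
      unfold soleDemand
      rw [if_neg fun hu => hvb (isVeryBig_of_mem_soleBigNeighborSet h1 hu)]
    omega

/-- In the absence of (RC1), the final charge of a vertex that is not big is nonnegative. -/
theorem charge_nonneg {R : RotationSystem G} {β : V → Bool} (hβ : ∀ v, β v = true ↔ IsBig G v)
    (h1 : ¬ HasRC1 G (max G.maxDegree (5 * 8680))) {x : V} :
    0 ≤ 2 * ((G.degree x : ℤ) + ∑ a : G.neighborSet x, (if β a = true then 1 else 0 : ℤ) - 6) -
      ∑ a : G.neighborSet x, (if β a = true then weight R a x - soleDemand G a x else 0) +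
      ∑ a, R.share β x a := by
  classical
  have hdeg := two_le_degree_of_not_hasRC1 h1
  have hlen := R.three_le_faceLen hdeg
  have hnn := Finset.sum_nonneg fun a (_ : a ∈ Finset.univ) =>
    RotationSystem.share_nonneg (R := R) (β := β) x a
  set b : ℤ := ∑ a : G.neighborSet x, (if β a = true then 1 else 0 : ℤ) with hb
  rcases Nat.lt_or_ge 5 (G.degree x) with h6 | h5
  · have hs : ∑ a : G.neighborSet x, (if β a = true then weight R a x - soleDemand G a x else 0) =
        2 * b := by
      rw [hb, Finset.mul_sum]
      refine Finset.sum_congr rfl fun a _ => ?_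
      rw [weight_of_six_le h6, soleDemand_of_six_le h6]
      split_ifs <;> norm_num
    rw [hs]
    have : (6 : ℤ) ≤ G.degree x := by exact_mod_cast h6
    linarith
  obtain ⟨v, hxv, hv⟩ := exists_isBig_of_not_hasRC1 h1 h5
  by_cases hsole : ∀ u, G.Adj x u → IsBig G u → u = v
  · have hiff : ∀ a : G.neighborSet x, β a = true ↔ a = ⟨v, hxv⟩ := fun a =>
      ⟨fun h => Subtype.ext (hsole a a.2 ((hβ _).mp h)), fun h => (hβ _).mpr (by rw [h]; exact hv)⟩
    have hb1 : b = 1 := by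
      rw [hb]
      simp only [hiff, Finset.sum_ite_eq', Finset.mem_univ, if_true]
    have hs : ∑ a : G.neighborSet x, (if β a = true then weight R a x - soleDemand G a x else 0) =
        weight R v x - soleDemand G v x := by
      simp only [hiff, Finset.sum_ite_eq', Finset.mem_univ, if_true]
    -- The demand is chosen so that a vertex with a single big neighbor ends with `1 - weight`.
    have hd : soleDemand G v x = 11 - 2 * (G.degree x : ℤ) := by
      unfold soleDemand
      rw [if_pos ⟨h5, hxv, hv, hsole⟩]
    have := weight_le_one (R := R) (v := v) h5
    rw [hb1, hs, hd]
    linarith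
  · push Not at hsole
    obtain ⟨w, hxw, hw, hwv⟩ := hsole
    have hne : (⟨v, hxv⟩ : G.neighborSet x) ≠ ⟨w, hxw⟩ := fun h => hwv (congrArg Subtype.val h).symm
    have hb2 : 2 ≤ b := by
      have h3 : ∑ a ∈ ({⟨v, hxv⟩, ⟨w, hxw⟩} : Finset (G.neighborSet x)),
          (if β a = true then 1 else 0 : ℤ) ≤ b :=
        Finset.sum_le_sum_of_subset_of_nonneg (Finset.subset_univ _)
          fun a _ _ => by split_ifs <;> norm_num
      rw [Finset.sum_pair hne, if_pos ((hβ _).mpr hv), if_pos ((hβ _).mpr hw)] at h3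
      linarith
    by_cases hbunch : ∃ v, InBunchOf R v x
    · obtain ⟨v, hvx⟩ := hbunch
      obtain ⟨hv, w, hw, hvw, hwx⟩ := hvx.exists_other
      have hshare := RotationSystem.le_sum_share_of_inBunchOf hβ hlen (hdeg x) hvx
      let v' : G.neighborSet x := ⟨v, hvx.adj.symm⟩
      let w' : G.neighborSet x := ⟨w, hwx.adj.symm⟩
      have hvw' : v' ≠ w' := fun h => hvw (congrArg Subtype.val h)
      -- Both parents have weight 0 at `x`, so at most `b - 2` is lost; with `b ≥ 2`, shares of `8 -
      -- 2 d(x)` are then enough.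
      have hs : ∑ a : G.neighborSet x,
          (if β a = true then weight R a x - soleDemand G a x else 0) ≤
          ∑ a : G.neighborSet x, ((if β a = true then 1 else 0 : ℤ) - (if a = v' then 1 else 0) -
            (if a = w' then 1 else 0)) := by
        refine Finset.sum_le_sum fun a _ => ?_
        have hs0 := soleDemand_nonneg (G := G) a x
        have hw1 := weight_le_one (R := R) (v := a) h5
        by_cases hav : a = v'
        · have ha0 : weight R a x = 0 := by
            unfold weight; rw [if_pos (by rw [hav]; exact hvx)]
          have hβa : β a = true := (hβ _).mpr (by rw [hav]; exact hv)
          rw [if_pos hβa, if_pos hβa, if_pos hav, if_neg (by rw [hav]; exact hvw')]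
          linarith
        · by_cases haw : a = w'
          · have ha0 : weight R a x = 0 := by
              unfold weight; rw [if_pos (by rw [haw]; exact hwx)]
            have hβa : β a = true := (hβ _).mpr (by rw [haw]; exact hw)
            rw [if_pos hβa, if_pos hβa, if_neg hav, if_pos haw]
            linarith
          · rw [if_neg hav, if_neg haw]
            split_ifs <;> linarith
      rw [Finset.sum_sub_distrib, Finset.sum_sub_distrib, Finset.sum_ite_eq', Finset.sum_ite_eq',
        if_pos (Finset.mem_univ _), if_pos (Finset.mem_univ _)] at hs
      linarith
    · push Not at hbunch
      have hshare := RotationSystem.le_sum_share_of_not_inBunchOf hβ hlen (hdeg x) hb2 hbunch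
      have hs : ∑ a : G.neighborSet x,
          (if β a = true then weight R a x - soleDemand G a x else 0) ≤ b := by
        refine Finset.sum_le_sum fun a _ => ?_
        have hs0 := soleDemand_nonneg (G := G) a x
        have hw1 := weight_le_one (R := R) (v := a) h5
        split_ifs <;> linarith
      linarith

end PlaneGraph

/-! ### The global count of charge -/

theorem mainTheorem2 {V : Type*} [Fintype V] (G : SimpleGraph V) [DecidableRel G.Adj]
    (E : PlaneGraph.PlaneEmbedding G) (hG : PlaneGraph.IsTwoConnected G) :
    PlaneGraph.HasRC1 G (max G.maxDegree (5 * 8680)) ∨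
      PlaneGraph.HasRC2 G ∨
      PlaneGraph.HasRC3 E.toRotationSystem ∨
      PlaneGraph.HasRC4 E.toRotationSystem := by
  classical
  by_contra! hcon
  obtain ⟨h1, h2, h3, h4⟩ := hcon
  set R := E.toRotationSystem with hR
  have hplanar : R.IsPlanar := E.isPlanar
  have hconn := hG.2.1
  have hdeg := PlaneGraph.two_le_degree_of_not_hasRC1 h1
  have hlen := R.three_le_faceLen hdeg
  let β : V → Bool := fun v => decide (PlaneGraph.IsBig G v)
  have hβ : ∀ v, β v = true ↔ PlaneGraph.IsBig G v := fun v => decide_eq_true_iff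
  have hnonempty : Nonempty G.Dart := by
    obtain ⟨v⟩ := hconn.nonempty
    have : (G.neighborFinset v).Nonempty := by
      rw [← Finset.card_pos, SimpleGraph.card_neighborFinset_eq_degree]
      have := hdeg v
      omega
    obtain ⟨w, hw⟩ := this
    exact ⟨⟨(v, w), (G.mem_neighborFinset v w).mp hw⟩⟩
  have heuler := hplanar.euler hconn
  have hD : Fintype.card G.Dart = 2 * G.edgeSet.ncard := by
    rw [G.dart_card_eq_twice_card_edges, ← SimpleGraph.coe_edgeFinset, Set.ncard_coe_finset]
  let N : Finset V := Finset.univ.filter fun v => ¬ β v = true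
  let B : Finset V := Finset.univ.filter fun v => β v = true
  let b : V → ℤ := fun x => ∑ a : G.neighborSet x, (if β a = true then 1 else 0 : ℤ)
  let t : V → V → ℤ := fun a x =>
    if β a = true then PlaneGraph.weight R a x - PlaneGraph.soleDemand G a x else 0
  have hsplit : ∀ φ : V → ℤ, ∑ x ∈ B, φ x + ∑ x ∈ N, φ x = ∑ x, φ x := fun φ =>
    Finset.sum_filter_add_sum_filter_not _ _ _
  -- edges inside the set of big vertices
  have hm : ∑ x ∈ B, b x ≤ 6 * (B.card : ℤ) + 4 ∧
      ({d : G.Dart | β d.fst = true ∧ β d.snd = true}.ncard : ℤ) = ∑ x ∈ B, b x := by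
    have e1 : ({d : G.Dart | β d.fst = true ∧ β d.snd = true}.ncard : ℤ) = ∑ x ∈ B, b x := by
      rw [Set.ncard_eq_toFinset_card', Finset.sum_filter]
      have : ∀ x, (if β x = true then b x else 0) = ∑ a : G.neighborSet x,
          (if β a = true ∧ β x = true then 1 else 0 : ℤ) := by
        intro x
        by_cases hx : β x = true
        · simp only [hx, and_true, if_true, b]
        · simp [hx]
      rw [Finset.sum_congr rfl fun x _ => this x]
      have h := PlaneGraph.sum_dart_eq_sum_snd (G := G)
        (fun d => if β d.fst = true ∧ β d.snd = true then (1 : ℤ) else 0)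
      refine Eq.trans ?_ h
      rw [Finset.sum_boole]
      congr 2
      ext d; simp
    refine ⟨?_, e1⟩
    have e2 := hplanar.card_edges_induce_le hconn {v | β v = true}
    have e3 : {v | β v = true}.ncard = B.card := by
      rw [Set.ncard_eq_toFinset_card']
      congr 1
      ext v; simp [B]
    rw [e3] at e2
    rw [← e1]
    exact_mod_cast e2
  obtain ⟨hm, hmeq⟩ := hm
  -- degree sums
  have hdegsum : ∑ x, (G.degree x : ℤ) = Fintype.card G.Dart := by
    rw [G.dart_card_eq_sum_degrees]; push_cast; rfl
  have hbsum : ∑ x, b x = ∑ x ∈ B, (G.degree x : ℤ) := by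
    have e1 := PlaneGraph.sum_dart_eq_sum_snd (G := G)
      (fun d => if β d.fst = true then (1 : ℤ) else 0)
    have e2 := PlaneGraph.sum_dart_eq_sum_fst (G := G)
      (fun v _ => if β v = true then (1 : ℤ) else 0)
    change _ = ∑ x, b x at e1
    rw [← e1, e2, Finset.sum_filter]
    refine Finset.sum_congr rfl fun v _ => ?_
    rw [PlaneGraph.sum_neighborSet_const]
    split_ifs <;> simp
  -- weights
  have ht : 36 * (B.card : ℤ) ≤ ∑ x, ∑ a : G.neighborSet x, t a x := by
    have e1 := PlaneGraph.sum_dart_eq_sum_snd (G := G) (fun d => t d.fst d.snd)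
    have e2 := PlaneGraph.sum_dart_eq_sum_fst (G := G) t
    change _ = ∑ x, ∑ a : G.neighborSet x, t a x at e1
    rw [← e1, e2, mul_comm, ← nsmul_eq_mul, ← Finset.sum_const, Finset.sum_filter]
    refine Finset.sum_le_sum fun v _ => ?_
    by_cases hv : β v = true
    · simp only [hv, if_true, t]
      exact PlaneGraph.le_sum_weight_sub_soleDemand h1 h2 h3 h4 ((hβ v).mp hv)
    · simp [hv, t]
  -- A big neighbor of a big vertex has weight 2 and no sole demand, so no charge moves between big
  -- vertices.
  have htB : ∑ x ∈ B, ∑ a : G.neighborSet x, t a x = 2 * ∑ x ∈ B, b x := by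
    rw [Finset.mul_sum]
    refine Finset.sum_congr rfl fun x hx => ?_
    have hbig : 8680 ≤ G.degree x := (hβ x).mp (Finset.mem_filter.mp hx).2
    simp only [b, t]
    rw [Finset.mul_sum]
    refine Finset.sum_congr rfl fun a _ => ?_
    rw [PlaneGraph.weight_of_six_le (by omega), PlaneGraph.soleDemand_of_six_le (by omega)]
    split_ifs <;> norm_num
  -- shares
  have hshare : ∑ x ∈ N, ∑ a, R.share β x a ≤
      4 * (Fintype.card G.Dart : ℤ) - 12 * Nat.card R.Face + 4 * ∑ x ∈ B, b x := by
    have e1 := R.sum_faceShare_le hlen β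
    have e2 := R.sum_triangleShare_le β
    rw [hmeq] at e2
    have e3 : ∑ x ∈ N, ∑ a, R.share β x a ≤
        ∑ d : G.Dart, (PlaneGraph.faceShare (R.faceLen d) (β d.fst) (β d.snd)
          (β (R.facePerm d).snd) + R.triangleShare β d) := by
      rw [PlaneGraph.sum_dart_eq_sum_snd]
      refine le_trans (Finset.sum_le_sum fun x hx => le_of_eq ?_)
        (Finset.sum_le_sum_of_subset_of_nonneg (Finset.subset_univ N) fun x _ _ =>
          Finset.sum_nonneg fun a _ => add_nonneg (PlaneGraph.faceShare_nonneg _ _ _ _)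
            (R.triangleShare_nonneg β _))
      refine Finset.sum_congr rfl fun a _ => ?_
      have hx' : β x = false := Bool.eq_false_iff.mpr (Finset.mem_filter.mp hx).2
      unfold PlaneGraph.RotationSystem.share PlaneGraph.cornerShare
        PlaneGraph.RotationSystem.triangleShare
      change _ = PlaneGraph.faceShare _ (β a) (β x) (β (R.next x a)) +
        if _ ∧ β a = true ∧ β x = false ∧ β (R.next x a) = true then 4 else 0
      simp only [hx', true_and]
    rw [Finset.sum_add_distrib] at e3
    linarith
  -- Inserting the bounds above, the total over `N` is at most `12 (E - F - V) - 24 |B| + 4 ∑ x ∈ B,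
  -- b x`, with `E`, `F`, `V` the numbers of edges, faces and vertices. This is at most `-24 + 16 <
  -- 0`.
  have hcharge := Finset.sum_nonneg fun x (_ : x ∈ N) =>
    PlaneGraph.charge_nonneg (R := R) hβ h1 (x := x)
  rw [Finset.sum_add_distrib, Finset.sum_sub_distrib, ← Finset.mul_sum, Finset.sum_sub_distrib,
    Finset.sum_add_distrib, Finset.sum_const, nsmul_eq_mul] at hcharge
  have s1 := hsplit b
  have s2 := hsplit fun x => (G.degree x : ℤ)
  have s3 := hsplit fun x => ∑ a : G.neighborSet x, t a x
  have s4 := hsplit fun _ => 1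
  simp only [Finset.sum_const, nsmul_eq_mul, mul_one, Finset.card_univ] at s4
  change 0 ≤ 2 * (∑ x ∈ N, (G.degree x : ℤ) + ∑ x ∈ N, b x - N.card * 6) -
    ∑ x ∈ N, ∑ a : G.neighborSet x, t a x + _ at hcharge
  have heuler' : (G.edgeSet.ncard : ℤ) + 2 ≤ Nat.card R.Face + Fintype.card V := by
    exact_mod_cast heuler
  have hD' : (Fintype.card G.Dart : ℤ) = 2 * G.edgeSet.ncard := by exact_mod_cast hD
  linarith
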